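/- **Setting.** Let $\mathcal A$ be a unital complex $*$-algebra with a state $\omega=\langle\cdot\rangle$, and let $\iota_x$ (space) and $\tau_t$ (time), $x,t\in\mathbb R$, be commuting one-parameter groups of $*$-endomorphisms of $\mathcal A$ that leave $\omega$ invariant. Let $\mathcal V\subset\mathcal A$ be a unital $*$-subalgebra (the local observables), invariant under all $\iota_x$; write $a(x,t)=\iota_x\tau_t a$, $a(x)=\iota_x a$. Assume that the correlation functions $\langle a_1(x_1,t_1)\cdots a_n(x_n,t_n)\rangle$, $a_i\in\mathcal V$, are jointly continuous, and that $x\mapsto\langle a(x,t)b\rangle-\langle a\rangle\langle b\rangle$ is integrable for all $a,b\in\mathcal V$, $t\in\mathbb R$. Connected correlation functions are denoted $\langle\cdots\rangle^{\rm c}$. Let $\widehat{\mathcal H}$ be the Hilbert space obtained from $\mathrm{span}\{\tau_t a: a\in\mathcal V,\,t\in\mathbb R\}$ with the positive semidefinite form $\langle a,b\rangle=\int_{\mathbb R}\langle a(x)^\dagger b\rangle^{\rm c}\,dx$ by dividing out null vectors and completing. Time evolution induces a group $\tau_t$ on $\widehat{\mathcal H}$; let $\mathbb P_\tau$ be the orthogonal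 projection onto the vectors invariant under all $\tau_t$, and for $\xi\in\widehat{\mathcal H}$ let $$\mathcal L^-_{\xi,\xi}=\liminf_{T\to\infty}\frac1{2T}\Big\|\int_{-T}^{T}(1-\mathbb P_\tau)\tau_t\xi\,dt\Big\|^2\in[0,\infty].$$ A *conserved density* $q\in\mathcal V$ with *current* $j\in\mathcal V$ is a self-adjoint observable with $\langle q\rangle=0$ such that $\partial_t q(x,t)+\partial_x j(x,t)=0$, in integrated form, inside all correlation functions of local observables. For conserved densities $q_i,q_j$ with formal total charges $Q_i=\int q_i(x)dx$, $Q_j=\int q_j(x)dx$, and for $\xi\in\widehat{\mathcal H}$, put $$\langle Q_iQ_j\,\xi\rangle^{\rm c}=\lim_{n\to\infty}\int_{-n}^{n}\big\langle (q_i(x)q_j)^\dagger,\xi\big\rangle\,dx$$ whenever the limit exists. *Clustering with velocity $v>0$:* for $n=2,3,4$ and all $a_1,\dots,a_n\in\mathcal V$ there are $C$ and $p>3$ such that $|\langle a_1(x_1,t_1)\cdots a_n(x_n,t_n)\rangle^{\rm c}|\le C(1+r)^{-p}$ whenever $r\ge0$ and the $n$ points split into two nonempty groups with $|x_i-x_j|\ge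 v|t_i-t_j|$ and $|x_i-x_j|\ge r$ for all $i$ in one group and $j$ in the other. **Theorem.** Let $q_i,q_j$ be conserved densities. 1. Assume clustering with some velocity $v>0$. For every $a\in\mathcal V$ for which $\langle Q_iQ_j(1-\mathbb P_\tau)a\rangle^{\rm c}$ exists, $$\mathcal L^-_{a,a}\;\ge\;\frac{\big|\langle Q_iQ_j(1-\mathbb P_\tau)a\rangle^{\rm c}\big|^2}{2v\big(\|q_i\|^2\|q_j\|^2+|\langle q_i,q_j\rangle|^2\big)}\qquad(*)$$ with norms and inner products of $\widehat{\mathcal H}$, and with $0/0=0$ and $c/0=\infty$ for $c>0$. The quantity exists whenever $\mathbb P_\tau a$ is the class of some $p\in\mathcal V$, and then it equals the absolutely convergent integral $\iint\langle q_i(x)q_j(y)(a-p)\rangle^{\rm c}dx\,dy$. In particular, if $j_k$ is the current of a conserved density and $\langle Q_iQ_j(1-\mathbb P_\tau)j_k\rangle^{\rm c}$ exists and is nonzero, then $\mathcal L^-_{kk}=\mathcal L^-_{j_k,j_k}>0$ (possibly $\infty$). 2. If clustering holds with every velocity $v>v_0$, where $v_0\ge0$, then $(*)$ holds with $v=v_0$.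 3. Suppose a Lieb–Robinson bound with velocity $v_{\rm LR}\ge0$ exists: there are a submultiplicative seminorm $N$ on $\mathcal A$ with $|\omega|\le N$, invariant under $\iota_x$ and $\tau_t$, and $*$-subalgebras $\mathcal A_{[l,r]}$, increasing in the interval, covariant under $\iota_x$ and commuting for disjoint intervals, such that for every $a\in\mathcal V$ there are $C$ and $\mu>0$ such that for all $t\in\mathbb R$, $R\ge0$ some $b\in\mathcal A_{[-v_{\rm LR}|t|-R,\;v_{\rm LR}|t|+R]}$ satisfies $N(\tau_ta-b)\le Ce^{-\mu R}$. Suppose also that the state is exponentially clustering in space: there are $C$ and $\kappa>0$ such that $|\omega(ab)-\omega(a)\omega(b)|\le C\,N(a)N(b)e^{-\kappa(l'-r)}$ for all $a\in\mathcal A_{[l,r]}$, $b\in\mathcal A_{[l',r']}$, $r\le l'$. Then clustering holds with every $v>v_{\rm LR}$, and $(*)$ holds with $v=v_{\rm LR}$. -/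

import Mathlib

open MeasureTheory Filter Topology
open scoped ENNReal

noncomputable section

namespace HydroProj

/-- A homogeneous and stationary one-dimensional many-body system. `A` is the `*`-algebra in which
products of observables are taken, `ω` the state, `ι x` and `τ t` the space and time translations
and `V` the algebra of local observables; the observable `a` at the space-time point `(x, t)` is
`ι x (τ t a)`. The algebra may be commutative (classical or stochastic systems, where `A` consists
of random variables) or not (quantum systems); local observables need not remain local under
time evolution. -/
structure System (A : Type*) [Ring A] [StarRing A] [Algebra ℂ A] [StarModule ℂ A] where
  ω : A →ₗ[ℂ] ℂ
  ω_one : ω 1 = 1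
  ω_nonneg : ∀ a, 0 ≤ (ω (star a * a)).re ∧ (ω (star a * a)).im = 0
  ι : ℝ → A →⋆ₐ[ℂ] A
  τ : ℝ → A →⋆ₐ[ℂ] A
  ι_zero : ∀ a, ι 0 a = a
  ι_add : ∀ x y a, ι (x + y) a = ι x (ι y a)
  τ_zero : ∀ a, τ 0 a = a
  τ_add : ∀ s t a, τ (s + t) a = τ s (τ t a)
  ι_τ_comm : ∀ x t a, ι x (τ t a) = τ t (ι x a)
  ω_ι : ∀ x a, ω (ι x a) = ω a
  ω_τ : ∀ t a, ω (τ t a) = ω a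
  V : StarSubalgebra ℂ A
  ι_mem : ∀ x, ∀ a ∈ V, ι x a ∈ V
  /-- correlation functions of local observables are continuous in the space-time positions -/
  continuous_corr : ∀ (n : ℕ) (a : Fin n → A), (∀ i, a i ∈ V) →
    Continuous fun p : Fin n → ℝ × ℝ =>
      ω (List.ofFn fun i => ι (p i).1 (τ (p i).2 (a i))).prod
  /-- connected two-point functions of local observables are integrable in space -/
  integrable_corr : ∀ a ∈ V, ∀ b ∈ V, ∀ t : ℝ,
    Integrable fun x : ℝ => ω (ι x (τ t a) * b) - ω a * ω b

variable {A : Type*} [Ring A] [StarRing A] [Algebra ℂ A] [StarModule ℂ A]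

namespace System

variable (S : System A)

/-! ### The first hydrodynamic space -/

/-- The space of all finite linear combinations of time-evolved local observables. -/
def nucleus : Submodule ℂ A :=
  Submodule.span ℂ {b | ∃ t : ℝ, ∃ a ∈ S.V, b = S.τ t a}

/-- The connected two-point function `⟨a(x)† b⟩ᶜ` at space separation `x`. -/
def cov (a b : A) (x : ℝ) : ℂ := S.ω (S.ι x (star a) * b) - S.ω (star a) * S.ω b

theorem ω_star (a : A) : S.ω (star a) = (starRingEnd ℂ) (S.ω a) := by
  have h1 := (S.ω_nonneg (1 + a)).2
  have h2 := (S.ω_nonneg (1 + Complex.I • a)).2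
  have h3 := (S.ω_nonneg a).2
  have e1 : star (1 + a) * (1 + a) = 1 + a + star a + star a * a := by
    simp [mul_add, add_mul]; abel
  have e2 : star (1 + Complex.I • a) * (1 + Complex.I • a)
      = 1 + Complex.I • a - Complex.I • star a + star a * a := by
    simp [mul_add, add_mul, star_smul, smul_smul]; abel
  rw [e1] at h1
  rw [e2] at h2
  simp only [map_add, map_sub, map_smul, S.ω_one, Complex.add_im, Complex.sub_im, h3,
    smul_eq_mul, Complex.mul_im, Complex.I_re, Complex.I_im, Complex.one_im] at h1 h2
  apply Complex.ext
  · simp; linarith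
  · simp; linarith

theorem cov_add_left (a b c : A) (x : ℝ) : S.cov (a + b) c x = S.cov a c x + S.cov b c x := by
  simp [cov, add_mul]; ring

theorem cov_add_right (a b c : A) (x : ℝ) : S.cov a (b + c) x = S.cov a b x + S.cov a c x := by
  simp [cov, mul_add]; ring

theorem cov_smul_left (r : ℂ) (a b : A) (x : ℝ) :
    S.cov (r • a) b x = (starRingEnd ℂ) r * S.cov a b x := by
  simp [cov, star_smul]; ring

theorem cov_smul_right (r : ℂ) (a b : A) (x : ℝ) : S.cov a (r • b) x = r * S.cov a b x := by
  simp [cov]; ring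

theorem cov_translate (a b : A) (y x : ℝ) : S.cov (S.ι y a) b x = S.cov a b (x + y) := by
  simp only [cov, ← map_star, ← S.ι_add, S.ω_ι]

theorem cov_swap (a b : A) (x : ℝ) : S.cov b a x = (starRingEnd ℂ) (S.cov a b (-x)) := by
  have h : S.ω (S.ι x (star b) * a) = S.ω (star b * S.ι (-x) a) := by
    rw [← S.ω_ι (-x), map_mul, ← S.ι_add]
    simp [S.ι_zero]
  simp only [cov, map_sub, map_mul, ← S.ω_star, star_mul, star_star, h, ← map_star]
  ring

theorem cov_evolve (a b : A) (t x : ℝ) : S.cov (S.τ t a) (S.τ t b) x = S.cov a b x := by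
  simp only [cov, ← map_star, S.ι_τ_comm, S.ω_τ, ← map_mul]

theorem cov_span (P : (ℝ → ℂ) → Prop) (h0 : P 0) (hadd : ∀ f g, P f → P g → P (f + g))
    (hmul : ∀ (r : ℂ) f, P f → P (fun x => r * f x))
    (h : ∀ a ∈ S.V, ∀ b ∈ S.V, ∀ t, P (S.cov (S.τ t a) b))
    {a b : A} (ha : a ∈ S.nucleus) (hb : b ∈ S.nucleus) : P (S.cov a b) := by
  induction ha using Submodule.span_induction with
  | zero => convert h0 using 1; ext x; simp [cov]
  | add u v _ _ hu hv =>
    convert hadd _ _ hu hv using 1; ext x; exact S.cov_add_left _ _ _ _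
  | smul r u _ hu =>
    convert hmul (starRingEnd ℂ r) _ hu using 1; ext x; exact S.cov_smul_left _ _ _ _
  | mem u hu =>
    obtain ⟨s, u, hu, rfl⟩ := hu
    induction hb using Submodule.span_induction with
    | zero => convert h0 using 1; ext x; simp [cov]
    | add u v _ _ hu hv =>
      convert hadd _ _ hu hv using 1; ext x; exact S.cov_add_right _ _ _ _
    | smul r u _ hu =>
      convert hmul r _ hu using 1; ext x; exact S.cov_smul_right _ _ _ _
    | mem w hw =>
      obtain ⟨t, w, hw, rfl⟩ := hw
      convert h u hu w hw (s - t) using 1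
      ext x
      rw [← S.cov_evolve (S.τ (s - t) u) w t x, ← S.τ_add, add_sub_cancel]

theorem cov_integrable {a b : A} (ha : a ∈ S.nucleus) (hb : b ∈ S.nucleus) :
    Integrable (S.cov a b) := by
  refine S.cov_span (fun f => Integrable f volume) (integrable_zero _ _ _) (fun _ _ => Integrable.add)
    (fun r f hf => hf.const_mul r) (fun a ha b hb t => ?_) ha hb
  refine (S.integrable_corr (star a) (star_mem ha) b hb t).congr (ae_of_all _ fun x => ?_)
  simp [cov, ← map_star, S.ω_τ]

theorem cov_continuous {a b : A} (ha : a ∈ S.nucleus) (hb : b ∈ S.nucleus) :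
    Continuous (S.cov a b) := by
  refine S.cov_span (fun f => Continuous f) continuous_zero (fun _ _ => Continuous.add)
    (fun r f hf => continuous_const.mul hf) (fun a ha b hb t => ?_) ha hb
  have h := (S.continuous_corr 2 ![star a, b] (by
    intro i; fin_cases i
    · exact star_mem ha
    · exact hb)).comp (f := fun x : ℝ => ![(x, t), (0, 0)]) (by fun_prop)
  refine (h.sub (continuous_const : Continuous fun _ : ℝ => S.ω (star a) * S.ω b)).congr (fun x => ?_)
  simp [cov, ← map_star, S.ω_τ, S.ι_zero, S.τ_zero]

/-- The Gelfand-Naimark-Segal pre-inner product `⟨a, b⟩ = ω (a† b)`. -/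
@[reducible]
def gnsCore : PreInnerProductSpace.Core ℂ A where
  inner a b := S.ω (star a * b)
  conj_inner_symm a b := by simp [← S.ω_star]
  re_inner_nonneg a := (S.ω_nonneg a).1
  add_left a b c := by simp [add_mul]
  smul_left a b r := by simp [star_smul]

/-- An integrable function of positive type has a nonnegative integral. -/
theorem integral_nonneg_of_posType {H : Type*} [NormedAddCommGroup H] [InnerProductSpace ℂ H]
    [CompleteSpace H] (ξ : ℝ → H) (hξ : Continuous ξ) (g : ℝ → ℂ) (hg : Integrable g)
    (h : ∀ s t, inner ℂ (ξ s) (ξ t) = g (s - t)) : 0 ≤ (∫ x, g x).re := by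
  have key : ∀ T : ℝ, 0 < T → 0 ≤ (∫ θ in (0:ℝ)..1, ∫ x in (T * θ - T)..(T * θ), g x).re := by
    intro T hT
    have h1 : ∫ s in (0:ℝ)..T, ∫ x in (s - T)..s, g x
        = inner ℂ (∫ s in (0:ℝ)..T, ξ s) (∫ t in (0:ℝ)..T, ξ t) := by
      rw [← inner_conj_symm]
      simp only [intervalIntegral.integral_of_le hT.le]
      rw [← integral_inner (hξ.integrableOn_Ioc), ← integral_conj]
      refine integral_congr_ae (ae_of_all _ fun s => ?_)
      simp only [inner_conj_symm]
      rw [← integral_inner (hξ.integrableOn_Ioc), ← intervalIntegral.integral_of_le hT.le]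
      simp only [h]
      simp
    have h2 : ∫ s in (0:ℝ)..T, ∫ x in (s - T)..s, g x
        = T • ∫ θ in (0:ℝ)..1, ∫ x in (T * θ - T)..(T * θ), g x := by
      rw [intervalIntegral.smul_integral_comp_mul_left (fun s => ∫ x in (s - T)..s, g x)]
      simp
    have h3 : 0 ≤ (T • ∫ θ in (0:ℝ)..1, ∫ x in (T * θ - T)..(T * θ), g x).re := by
      rw [← h2, h1]; exact inner_self_nonneg (𝕜 := ℂ)
    rw [Complex.real_smul, Complex.re_ofReal_mul] at h3
    exact nonneg_of_mul_nonneg_right h3 hT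
  have lim : Tendsto (fun T : ℝ => ∫ θ in (0:ℝ)..1, ∫ x in (T * θ - T)..(T * θ), g x) atTop
      (𝓝 (∫ θ in (0:ℝ)..1, ∫ x, g x)) := by
    refine intervalIntegral.tendsto_integral_filter_of_dominated_convergence
      (fun _ => ∫ x, ‖g x‖) ?_ ?_ (by simp) ?_
    · refine Eventually.of_forall fun T => ?_
      have hc : Continuous fun u : ℝ => ∫ x in (0:ℝ)..u, g x :=
        intervalIntegral.continuous_primitive (fun a b => hg.intervalIntegrable) 0
      have : (fun θ : ℝ => ∫ x in (T * θ - T)..(T * θ), g x)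
          = fun θ => (∫ x in (0:ℝ)..(T * θ), g x) - ∫ x in (0:ℝ)..(T * θ - T), g x := by
        ext θ
        rw [intervalIntegral.integral_interval_sub_left hg.intervalIntegrable
          hg.intervalIntegrable]
      rw [this]
      exact ((hc.comp (by fun_prop)).sub (hc.comp (by fun_prop))).aestronglyMeasurable
    · filter_upwards [eventually_gt_atTop 0] with T hT
      refine ae_of_all _ fun θ _ => ?_
      rw [intervalIntegral.integral_of_le (by linarith)]
      exact (norm_integral_le_integral_norm _).trans
        (setIntegral_le_integral hg.norm (ae_of_all _ fun _ => norm_nonneg _))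
    · have hne : ∀ᵐ θ : ℝ, θ ≠ 1 := by simp [ae_iff, measure_singleton]
      filter_upwards [hne] with θ hθ hθ'
      rw [Set.uIoc_of_le zero_le_one] at hθ'
      have hlt : θ - 1 < 0 := by
        rcases lt_or_eq_of_le hθ'.2 with h | h
        · linarith
        · exact absurd h hθ
      refine intervalIntegral_tendsto_integral hg ?_ ?_
      · refine (tendsto_id.atTop_mul_const_of_neg hlt).congr (fun T => ?_)
        simp; ring
      · exact tendsto_id.atTop_mul_const hθ'.1
  have lim' := (Complex.continuous_re.tendsto _).comp lim
  rw [intervalIntegral.integral_const] at lim'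
  have := ge_of_tendsto lim' (by
    filter_upwards [eventually_gt_atTop 0] with T hT using key T hT)
  simpa using this

theorem cov_integral_nonneg {a : A} (ha : a ∈ S.nucleus) : 0 ≤ (∫ x, S.cov a a x).re := by
  let c : PreInnerProductSpace.Core ℂ A := S.gnsCore
  let : SeminormedAddCommGroup A := InnerProductSpace.Core.toSeminormedAddCommGroup (𝕜 := ℂ)
  let : InnerProductSpace ℂ A := InnerProductSpace.ofCore c
  have hin : ∀ u v : A, inner ℂ u v = S.ω (star u * v) := fun _ _ => rfl
  let η : ℝ → A := fun s => S.ι s (a - algebraMap ℂ A (S.ω a))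
  have hη : ∀ s t, inner ℂ (η s) (η t) = S.cov a a (s - t) := by
    intro s t
    have e : S.ω (star (η s) * η t)
        = S.ω (S.ι (s - t) (star (a - algebraMap ℂ A (S.ω a))) * (a - algebraMap ℂ A (S.ω a))) := by
      rw [← S.ω_ι t (S.ι (s - t) _ * _), map_mul (S.ι t), ← S.ι_add]
      simp only [η, ← map_star, add_sub_cancel]
    rw [hin, e]
    simp only [cov, star_sub, map_sub, sub_mul, mul_sub]
    simp only [Algebra.algebraMap_eq_smul_one, star_smul, star_one, map_smul, map_one,
      smul_mul_assoc, mul_smul_comm, one_mul, mul_one, S.ω_one, S.ω_ι, smul_eq_mul, S.ω_star]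
    simp only [RCLike.star_def]
    ring
  have hηc : Continuous η := by
    have hn : ∀ s t, ‖η s - η t‖ ^ 2 = 2 * (S.cov a a 0).re - 2 * (S.cov a a (s - t)).re := by
      intro s t
      have := norm_sub_sq (𝕜 := ℂ) (η s) (η t)
      rw [← inner_self_eq_norm_sq (𝕜 := ℂ) (η s), ← inner_self_eq_norm_sq (𝕜 := ℂ) (η t)] at this
      simp only [hη, sub_self] at this
      simp only [RCLike.re_eq_complex_re] at this
      linarith
    rw [continuous_iff_continuousAt]
    intro t
    rw [ContinuousAt, tendsto_iff_norm_sub_tendsto_zero]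
    have hc : Continuous fun s => ‖η s - η t‖ ^ 2 := by
      simp only [hn]
      exact continuous_const.sub (continuous_const.mul (Complex.continuous_re.comp
        ((S.cov_continuous ha ha).comp (continuous_id.sub continuous_const))))
    have h0 := hc.tendsto t
    have h1 := (Real.continuous_sqrt.tendsto _).comp h0
    simpa [Function.comp_def, Real.sqrt_sq] using h1
  refine integral_nonneg_of_posType (H := UniformSpace.Completion A)
    (fun s => (η s : UniformSpace.Completion A))
    ((UniformSpace.Completion.continuous_coe A).comp hηc) (S.cov a a) (S.cov_integrable ha ha) ?_
  intro s t
  rw [UniformSpace.Completion.inner_coe, hη]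

/-- The nucleus, carrying the positive semidefinite form `⟨a, b⟩ = ∫ ⟨a(x)† b⟩ᶜ dx`. -/
def Nuc : Type _ := S.nucleus

instance : AddCommGroup S.Nuc := inferInstanceAs (AddCommGroup S.nucleus)

instance : Module ℂ S.Nuc := inferInstanceAs (Module ℂ S.nucleus)

/-- The underlying observable of an element of the nucleus. -/
def Nuc.val {S : System A} (a : S.Nuc) : A := Subtype.val (p := fun b => b ∈ S.nucleus) a

/-- An element of the nucleus from an observable. -/
def Nuc.mk {S : System A} (a : A) (ha : a ∈ S.nucleus) : S.Nuc := ⟨a, ha⟩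

theorem Nuc.val_mem {S : System A} (a : S.Nuc) : a.val ∈ S.nucleus := a.2

/-- The form `⟨a, b⟩ = ∫ ⟨a(x)† b⟩ᶜ dx` is a positive semidefinite sesquilinear form. -/
@[reducible]
def core : PreInnerProductSpace.Core ℂ S.Nuc where
  inner a b := ∫ x, S.cov a.val b.val x
  conj_inner_symm a b := by
    rw [← integral_conj, ← integral_neg_eq_self]
    exact integral_congr_ae (ae_of_all _ fun x => (S.cov_swap b.val a.val x).symm)
  re_inner_nonneg a := S.cov_integral_nonneg a.val_mem
  add_left a b c := by
    rw [← integral_add (S.cov_integrable a.val_mem c.val_mem)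
      (S.cov_integrable b.val_mem c.val_mem)]
    exact integral_congr_ae (ae_of_all _ fun x => S.cov_add_left _ _ _ x)
  smul_left a b r := by
    rw [← integral_const_mul]
    exact integral_congr_ae (ae_of_all _ fun x => S.cov_smul_left _ _ _ x)

instance : SeminormedAddCommGroup S.Nuc :=
  @InnerProductSpace.Core.toSeminormedAddCommGroup ℂ S.Nuc _ _ _ S.core

instance : InnerProductSpace ℂ S.Nuc := InnerProductSpace.ofCore S.core

theorem inner_nuc (a b : S.Nuc) : inner ℂ a b = ∫ x, S.cov a.val b.val x := rfl

/-- The first hydrodynamic space: null vectors of the form `∫ ⟨a(x)† b⟩ᶜ dx` are divided out and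
the quotient is completed (both are done by the Hausdorff completion). -/
abbrev Hhat : Type _ := UniformSpace.Completion S.Nuc

/-- The class in `Hhat` of the local observable `a`. -/
def cls (a : S.V) : S.Hhat :=
  ((Nuc.mk (a : A) (Submodule.subset_span ⟨0, a, a.2, (S.τ_zero _).symm⟩) : S.Nuc) : S.Hhat)

theorem evolve_mem (t : ℝ) {a : A} (ha : a ∈ S.nucleus) : S.τ t a ∈ S.nucleus := by
  induction ha using Submodule.span_induction with
  | zero => simp
  | add u v _ _ hu hv => rw [map_add]; exact add_mem hu hv
  | smul r u _ hu => rw [map_smul]; exact Submodule.smul_mem _ _ hu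
  | mem u hu =>
    obtain ⟨s, u, hu, rfl⟩ := hu
    exact Submodule.subset_span ⟨t + s, u, hu, (S.τ_add t s u).symm⟩

/-- Time evolution on the nucleus. -/
def evolveNuc (t : ℝ) : S.Nuc →ₗᵢ[ℂ] S.Nuc where
  toFun a := Nuc.mk (S.τ t a.val) (S.evolve_mem t a.val_mem)
  map_add' a b := Subtype.ext (map_add (S.τ t) a.val b.val)
  map_smul' r a := Subtype.ext (map_smul (S.τ t) r a.val)
  norm_map' a := by
    have h : inner ℂ (Nuc.mk (S.τ t a.val) (S.evolve_mem t a.val_mem) : S.Nuc)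
        (Nuc.mk (S.τ t a.val) (S.evolve_mem t a.val_mem)) = inner ℂ a a :=
      integral_congr_ae (ae_of_all _ fun x => S.cov_evolve a.val a.val t x)
    rw [@norm_eq_sqrt_re_inner ℂ, @norm_eq_sqrt_re_inner ℂ _ _ _ _ a]
    exact congrArg _ (congrArg _ h)

/-- Time evolution on `Hhat`. -/
def evolve (t : ℝ) : S.Hhat →L[ℂ] S.Hhat := (S.evolveNuc t).toContinuousLinearMap.completion

/-- The ballistic space: the vectors of `Hhat` that are invariant under time evolution. -/
def ballistic : Submodule ℂ S.Hhat := ⨅ t : ℝ, (S.evolve t - 1).ker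

instance : CompleteSpace S.ballistic := by
  have h : IsClosed (S.ballistic : Set S.Hhat) := by
    rw [ballistic, Submodule.coe_iInf]
    exact isClosed_iInter fun t => (S.evolve t - 1).isClosed_ker
  exact h.completeSpace_coe

/-- The projection `1 - P_τ`, with `P_τ` the orthogonal projection onto the ballistic space. -/
def coProj : S.Hhat →L[ℂ] S.Hhat := 1 - S.ballistic.starProjection

/-- The diagonal element `L⁻(ξ, ξ)` of the lower Onsager matrix, that is
`liminf_{T → ∞} (1 / 2T) ‖∫_{-T}^{T} (1 - P_τ) τ_t ξ dt‖²`. -/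
def lowerOnsager (ξ : S.Hhat) : ℝ≥0∞ :=
  liminf (fun T : ℝ =>
    ENNReal.ofReal (‖∫ t in (-T)..T, S.coProj (S.evolve t ξ)‖ ^ 2 / (2 * T))) atTop

/-! ### Connected correlation functions and clustering -/

/-- The observable `a` with its average subtracted. -/
def centre (a : A) : A := a - algebraMap ℂ A (S.ω a)

/-- Connected two-point function. -/
def conn₂ (a : Fin 2 → A) : ℂ := S.ω (S.centre (a 0) * S.centre (a 1))

/-- Connected three-point function. -/
def conn₃ (a : Fin 3 → A) : ℂ := S.ω (S.centre (a 0) * S.centre (a 1) * S.centre (a 2))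

/-- Connected four-point function. -/
def conn₄ (a : Fin 4 → A) : ℂ :=
  S.ω (S.centre (a 0) * S.centre (a 1) * S.centre (a 2) * S.centre (a 3))
    - S.ω (S.centre (a 0) * S.centre (a 1)) * S.ω (S.centre (a 2) * S.centre (a 3))
    - S.ω (S.centre (a 0) * S.centre (a 2)) * S.ω (S.centre (a 1) * S.centre (a 3))
    - S.ω (S.centre (a 0) * S.centre (a 3)) * S.ω (S.centre (a 1) * S.centre (a 2))

/-- The `n`-point function `K` of local observables decays fast and uniformly in the positions
when the points split into two nonempty groups, every point of one group being outside the
light cone, of velocity `v`, of every point of the other group: if moreover all distances between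
the two groups are at least `r`, then `K = O(r ^ (-p))` for some power `p > 3`. -/
def ClusteringOf (v : ℝ) (n : ℕ) (K : (Fin n → A) → ℂ) : Prop :=
  ∀ a : Fin n → A, (∀ i, a i ∈ S.V) → ∃ C p : ℝ, 3 < p ∧
    ∀ (x t : Fin n → ℝ) (I : Finset (Fin n)), I.Nonempty → Iᶜ.Nonempty → ∀ r : ℝ, 0 ≤ r →
      (∀ i ∈ I, ∀ j ∈ Iᶜ, v * |t i - t j| ≤ |x i - x j| ∧ r ≤ |x i - x j|) →
        ‖K fun i => S.ι (x i) (S.τ (t i) (a i))‖ ≤ C * (1 + r) ^ (-p)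

/-- Space-time clustering with velocity `v` of connected two-, three- and four-point functions. -/
def Clustering (v : ℝ) : Prop :=
  S.ClusteringOf v 2 S.conn₂ ∧ S.ClusteringOf v 3 S.conn₃ ∧ S.ClusteringOf v 4 S.conn₄

/-! ### Conserved densities and bilinear charges -/

/-- A product of observables at space-time points: the entry `(a, x, t)` stands for `a(x, t)`. -/
def prodAt (l : List (S.V × ℝ × ℝ)) : A :=
  (l.map fun p => S.ι p.2.1 (S.τ p.2.2 (p.1 : A))).prod

/-- `q` is a conserved density with current `j`: a self-adjoint local observable of zero average
obeying `∂_t q + ∂_x j = 0`. The conservation law is written in integrated form, and holds within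
all correlation functions. -/
structure IsConserved (q j : S.V) : Prop where
  star_eq : star (q : A) = q
  average_eq_zero : S.ω q = 0
  law : ∀ (l m : List (S.V × ℝ × ℝ)) (x₁ x₂ t₁ t₂ : ℝ),
    (∫ x in x₁..x₂, S.ω (S.prodAt (l ++ (q, x, t₂) :: m)))
        - (∫ x in x₁..x₂, S.ω (S.prodAt (l ++ (q, x, t₁) :: m)))
      + (∫ t in t₁..t₂, S.ω (S.prodAt (l ++ (j, x₂, t) :: m)))
        - (∫ t in t₁..t₂, S.ω (S.prodAt (l ++ (j, x₁, t) :: m))) = 0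

/-- The translate of a local observable. -/
def shift (x : ℝ) (a : S.V) : S.V := ⟨S.ι x a, S.ι_mem x a a.2⟩

/-- `⟨Q Q' ξ⟩ᶜ = z`, for `Q` and `Q'` the total charges of the self-adjoint densities `q` and `q'`
and for a vector `ξ` of `Hhat`: the pairings of `ξ` with `∫_{-n}^{n} (q(x) q')† dx` tend to `z`. -/
def BilinearValue (q q' : S.V) (ξ : S.Hhat) (z : ℂ) : Prop :=
  Tendsto (fun n : ℝ => ∫ x in (-n)..n, inner ℂ (S.cls (star (S.shift x q * q'))) ξ) atTop (𝓝 z)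

/-- `⟨Q Q' b⟩ᶜ` for a local observable `b`: the integrated connected three-point function. -/
def bilinear (q q' b : S.V) : ℂ :=
  ∫ p : ℝ × ℝ, S.conn₃ ![S.ι p.1 (q : A), S.ι p.2 (q' : A), (b : A)]

/-- The lower bound on diffusion from the bilinear charge of `q` and `q'`, with velocity `v`. -/
def DiffusionBound (q q' : S.V) (v : ℝ) : Prop :=
  ∀ (a : S.V) (z : ℂ), S.BilinearValue q q' (S.coProj (S.cls a)) z →
    ENNReal.ofReal (‖z‖ ^ 2) /
        ENNReal.ofReal (2 * v *
          (‖S.cls q‖ ^ 2 * ‖S.cls q'‖ ^ 2 + ‖inner ℂ (S.cls q) (S.cls q')‖ ^ 2))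
      ≤ S.lowerOnsager (S.cls a)

/-! ### Lieb-Robinson bounds -/

/-- A local structure: a norm on observables for which the state is bounded and translations are
isometric, and for each interval `[l, r]` the algebra of observables supported there. -/
structure LocalNet where
  N : Seminorm ℂ A
  N_mul : ∀ a b, N (a * b) ≤ N a * N b
  ω_le : ∀ a, ‖S.ω a‖ ≤ N a
  N_ι : ∀ x a, N (S.ι x a) = N a
  N_τ : ∀ t a, N (S.τ t a) = N a
  loc : ℝ → ℝ → StarSubalgebra ℂ A
  mono : ∀ {l l' r r' : ℝ}, l' ≤ l → r ≤ r' → loc l r ≤ loc l' r'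
  covariant : ∀ (x l r : ℝ), ∀ a ∈ loc l r, S.ι x a ∈ loc (l + x) (r + x)
  commute : ∀ (l r l' r' : ℝ), r < l' → ∀ a ∈ loc l r, ∀ b ∈ loc l' r', a * b = b * a

variable {S}

/-- Lieb-Robinson bound with velocity `v`: up to an error exponentially small in `R`, the time
evolution of a local observable is supported in the light cone enlarged by `R`. -/
def LocalNet.LiebRobinson (M : S.LocalNet) (v : ℝ) : Prop :=
  ∀ a ∈ S.V, ∃ C μ : ℝ, 0 < μ ∧ ∀ t R : ℝ, 0 ≤ R →
    ∃ b ∈ M.loc (-(v * |t| + R)) (v * |t| + R), M.N (S.τ t a - b) ≤ C * Real.exp (-(μ * R))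

/-- Exponential clustering of the state in space, at a fixed time. -/
def LocalNet.ExpClustering (M : S.LocalNet) : Prop :=
  ∃ C κ : ℝ, 0 < κ ∧ ∀ l r l' r' : ℝ, r ≤ l' → ∀ a ∈ M.loc l r, ∀ b ∈ M.loc l' r',
    ‖S.ω (a * b) - S.ω a * S.ω b‖ ≤ C * M.N a * M.N b * Real.exp (-(κ * (l' - r)))

end System

end HydroProj

end

noncomputable section

namespace HydroProj

/-! ### Elementary estimates -/

theorem integrable_one_add_abs_div {p k : ℝ} (hp : 1 < p) (hk : 0 < k) :
    Integrable fun x : ℝ => (1 + |x| / k) ^ (-p) := by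
  have h := (integrable_one_add_norm (E := ℝ) (μ := volume) (r := p) (by simpa using hp)).comp_div
    hk.ne'
  refine h.congr (ae_of_all _ fun x => ?_)
  simp [abs_of_pos hk]

/-- A bound by three powers separately is a bound by the product of their cube roots. -/
theorem le_mul_rpow_three {B C p u v w : ℝ} (hC : 0 ≤ C) (hp : 0 ≤ p) (hu : 1 ≤ u) (hv : 1 ≤ v)
    (hw : 1 ≤ w) (h₁ : B ≤ C * u ^ (-p)) (h₂ : B ≤ C * v ^ (-p)) (h₃ : B ≤ C * w ^ (-p)) :
    B ≤ C * (u ^ (-(p / 3)) * (v ^ (-(p / 3)) * w ^ (-(p / 3)))) := by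
  have key : ∀ m : ℝ, u ≤ m → v ≤ m → w ≤ m → B ≤ C * m ^ (-p) →
      B ≤ C * (u ^ (-(p / 3)) * (v ^ (-(p / 3)) * w ^ (-(p / 3)))) := by
    intro m hum hvm hwm hB
    refine hB.trans (mul_le_mul_of_nonneg_left ?_ hC)
    have hm : 0 < m := by linarith
    have e : m ^ (-p) = m ^ (-(p / 3)) * (m ^ (-(p / 3)) * m ^ (-(p / 3))) := by
      rw [← Real.rpow_add hm, ← Real.rpow_add hm]
      congr 1
      ring
    have hp' : -(p / 3) ≤ 0 := by linarith
    have a₁ := Real.rpow_le_rpow_of_nonpos (by linarith) hum hp'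
    have a₂ := Real.rpow_le_rpow_of_nonpos (by linarith) hvm hp'
    have a₃ := Real.rpow_le_rpow_of_nonpos (by linarith) hwm hp'
    rw [e]
    gcongr
  rcases le_total u v with huv | huv
  · rcases le_total v w with hvw | hvw
    · exact key w (huv.trans hvw) hvw le_rfl h₃
    · exact key v huv le_rfl hvw h₂
  · rcases le_total u w with huw | huw
    · exact key w huw (huv.trans huw) le_rfl h₃
    · exact key u le_rfl huv huw h₁

/-- At most four points on the line leave free one third of the interval between any two of
them. -/
theorem exists_gap {n : ℕ} (hn : n ≤ 4) (y : Fin n → ℝ) (i j : Fin n) (h : y i < y j) :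
    ∃ s, y i ≤ s ∧ s + (y j - y i) / 3 ≤ y j ∧ ∀ k, y k ≤ s ∨ s + (y j - y i) / 3 ≤ y k := by
  by_contra! H
  obtain ⟨k₀, a₀, b₀⟩ := H (y i) le_rfl (by linarith)
  obtain ⟨k₁, a₁, b₁⟩ := H (y i + (y j - y i) / 3) (by linarith) (by linarith)
  obtain ⟨k₂, a₂, b₂⟩ := H (y i + 2 * (y j - y i) / 3) (by linarith) (by linarith)
  have ne : ∀ {k l : Fin n}, y k < y l → k ≠ l := fun hlt e => by simp [e] at hlt
  have hc : ({i, k₀, k₁, k₂, j} : Finset (Fin n)).card = 5 := by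
    rw [Finset.card_insert_of_notMem, Finset.card_insert_of_notMem, Finset.card_insert_of_notMem,
      Finset.card_insert_of_notMem, Finset.card_singleton]
    all_goals simp only [Finset.mem_insert, Finset.mem_singleton, not_or]
    · exact ne (by linarith)
    · exact ⟨ne (by linarith), ne (by linarith)⟩
    · exact ⟨ne (by linarith), ne (by linarith), ne (by linarith)⟩
    · exact ⟨ne (by linarith), ne (by linarith), ne (by linarith), ne (by linarith)⟩
  have := Finset.card_le_univ ({i, k₀, k₁, k₂, j} : Finset (Fin n))
  rw [hc, Fintype.card_fin] at this
  omega

namespace System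

variable {A : Type*} [Ring A] [StarRing A] [Algebra ℂ A] [StarModule ℂ A] (S : System A)

/-! ### Observables at space-time points -/

/-- The observable `a` at the space-time point `(x, t)`. -/
abbrev put (x t : ℝ) (a : A) : A := S.ι x (S.τ t a)

theorem ω_put (x t : ℝ) (a : A) : S.ω (S.put x t a) = S.ω a := by rw [S.ω_ι, S.ω_τ]

theorem put_zero_zero (a : A) : S.put 0 0 a = a := by rw [put, S.τ_zero, S.ι_zero]

theorem put_put (x t y s : ℝ) (a : A) : S.put x t (S.put y s a) = S.put (x + y) (t + s) a := by
  simp only [put]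
  rw [← S.ι_τ_comm, ← S.τ_add, ← S.ι_add]

theorem put_mul (x t : ℝ) (a b : A) : S.put x t (a * b) = S.put x t a * S.put x t b := by
  simp [put]

theorem ω_centre (a : A) : S.ω (S.centre a) = 0 := by
  simp [centre, Algebra.algebraMap_eq_smul_one, S.ω_one]

theorem centre_put (x t : ℝ) (a : A) : S.centre (S.put x t a) = S.put x t (S.centre a) := by
  simp only [centre, S.ω_put]
  simp [put, Algebra.algebraMap_eq_smul_one]

theorem centre_mem {a : A} (ha : a ∈ S.V) : S.centre a ∈ S.V :=
  sub_mem ha (algebraMap_mem S.V _)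

theorem centre_eq_self {a : A} (h : S.ω a = 0) : S.centre a = a := by simp [centre, h]

theorem star_centre (a : A) : star (S.centre a) = S.centre (star a) := by
  simp [centre, S.ω_star, Algebra.algebraMap_eq_smul_one, star_smul]

theorem ω_mul_centre (a b : A) : S.ω (a * S.centre b) = S.ω (a * b) - S.ω a * S.ω b := by
  simp [centre, mul_sub, Algebra.algebraMap_eq_smul_one, mul_comm]

theorem ω_centre_mul (a b : A) : S.ω (S.centre a * b) = S.ω (a * b) - S.ω a * S.ω b := by
  simp [centre, sub_mul, Algebra.algebraMap_eq_smul_one]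

theorem cov_eq (a b : A) (x : ℝ) : S.cov a b x = S.ω (S.ι x (star a) * S.centre b) := by
  rw [S.ω_mul_centre, S.ω_ι, cov]

/-! ### Continuity of correlation functions -/

variable {X : Type*} [TopologicalSpace X]

theorem continuous_corr₂ {a b : A} (ha : a ∈ S.V) (hb : b ∈ S.V) {x₁ t₁ x₂ t₂ : X → ℝ}
    (hx₁ : Continuous x₁) (ht₁ : Continuous t₁) (hx₂ : Continuous x₂) (ht₂ : Continuous t₂) :
    Continuous fun p => S.ω (S.put (x₁ p) (t₁ p) a * S.put (x₂ p) (t₂ p) b) := by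
  have h := (S.continuous_corr 2 ![a, b] (by intro i; fin_cases i <;> assumption)).comp
    (f := fun p : X => ![(x₁ p, t₁ p), (x₂ p, t₂ p)]) (by fun_prop)
  refine h.congr fun p => ?_
  simp [put]

theorem continuous_corr₃ {a b c : A} (ha : a ∈ S.V) (hb : b ∈ S.V) (hc : c ∈ S.V)
    {x₁ t₁ x₂ t₂ x₃ t₃ : X → ℝ} (hx₁ : Continuous x₁) (ht₁ : Continuous t₁) (hx₂ : Continuous x₂)
    (ht₂ : Continuous t₂) (hx₃ : Continuous x₃) (ht₃ : Continuous t₃) :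
    Continuous fun p => S.ω (S.put (x₁ p) (t₁ p) a * S.put (x₂ p) (t₂ p) b
      * S.put (x₃ p) (t₃ p) c) := by
  have h := (S.continuous_corr 3 ![a, b, c] (by intro i; fin_cases i <;> assumption)).comp
    (f := fun p : X => ![(x₁ p, t₁ p), (x₂ p, t₂ p), (x₃ p, t₃ p)]) (by fun_prop)
  refine h.congr fun p => ?_
  simp [put, List.ofFn_succ, mul_assoc]

theorem continuous_corr₄ {a b c d : A} (ha : a ∈ S.V) (hb : b ∈ S.V) (hc : c ∈ S.V)
    (hd : d ∈ S.V) {x₁ x₂ x₃ x₄ : X → ℝ} (hx₁ : Continuous x₁) (hx₂ : Continuous x₂)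
    (hx₃ : Continuous x₃) (hx₄ : Continuous x₄) :
    Continuous fun p => S.ω (S.ι (x₁ p) a * S.ι (x₂ p) b * S.ι (x₃ p) c * S.ι (x₄ p) d) := by
  have h := (S.continuous_corr 4 ![a, b, c, d] (by intro i; fin_cases i <;> assumption)).comp
    (f := fun p : X => ![(x₁ p, 0), (x₂ p, 0), (x₃ p, 0), (x₄ p, 0)]) (by fun_prop)
  refine h.congr fun p => ?_
  simp [List.ofFn_succ, mul_assoc, S.τ_zero]

/-! ### Consequences of clustering -/

variable {S}

theorem clustering₂ {v : ℝ} (h : S.ClusteringOf v 2 S.conn₂) {a b : A} (ha : a ∈ S.V)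
    (hb : b ∈ S.V) : ∃ C p : ℝ, 0 ≤ C ∧ 3 < p ∧ ∀ x₁ t₁ x₂ t₂ r : ℝ, 0 ≤ r →
      v * |t₁ - t₂| ≤ |x₁ - x₂| → r ≤ |x₁ - x₂| →
      ‖S.ω (S.put x₁ t₁ (S.centre a) * S.put x₂ t₂ (S.centre b))‖ ≤ C * (1 + r) ^ (-p) := by
  obtain ⟨C, p, hp, H⟩ := h ![a, b] (by intro i; fin_cases i <;> assumption)
  refine ⟨|C|, p, abs_nonneg C, hp, fun x₁ t₁ x₂ t₂ r hr h₁ h₂ => ?_⟩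
  have := H ![x₁, x₂] ![t₁, t₂] {0} (by simp) ⟨1, by simp⟩ r hr (by
    intro i hi j hj
    fin_cases i <;> fin_cases j <;> simp_all)
  refine le_trans (le_of_eq ?_) (this.trans
    (mul_le_mul_of_nonneg_right (le_abs_self C) (by positivity)))
  simp [conn₂, ← S.centre_put, put]

theorem clustering₃ {v : ℝ} (h : S.ClusteringOf v 3 S.conn₃) {a b c : A} (ha : a ∈ S.V)
    (hb : b ∈ S.V) (hc : c ∈ S.V) : ∃ C p : ℝ, 0 ≤ C ∧ 3 < p ∧
      ∀ x₁ t₁ x₂ t₂ x₃ t₃ r : ℝ, 0 ≤ r →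
      ((v * |t₁ - t₂| ≤ |x₁ - x₂| ∧ r ≤ |x₁ - x₂|) ∧ (v * |t₁ - t₃| ≤ |x₁ - x₃| ∧ r ≤ |x₁ - x₃|) ∨
       (v * |t₁ - t₂| ≤ |x₁ - x₂| ∧ r ≤ |x₁ - x₂|) ∧ (v * |t₂ - t₃| ≤ |x₂ - x₃| ∧ r ≤ |x₂ - x₃|) ∨
       (v * |t₁ - t₃| ≤ |x₁ - x₃| ∧ r ≤ |x₁ - x₃|) ∧ (v * |t₂ - t₃| ≤ |x₂ - x₃| ∧ r ≤ |x₂ - x₃|)) →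
      ‖S.ω (S.put x₁ t₁ (S.centre a) * S.put x₂ t₂ (S.centre b) * S.put x₃ t₃ (S.centre c))‖
        ≤ C * (1 + r) ^ (-p) := by
  obtain ⟨C, p, hp, H⟩ := h ![a, b, c] (by intro i; fin_cases i <;> assumption)
  refine ⟨|C|, p, abs_nonneg C, hp, fun x₁ t₁ x₂ t₂ x₃ t₃ r hr h₁ => ?_⟩
  have key : ∃ i : Fin 3, ∀ j, j ≠ i → v * |![t₁, t₂, t₃] i - ![t₁, t₂, t₃] j| ≤
      |![x₁, x₂, x₃] i - ![x₁, x₂, x₃] j| ∧ r ≤ |![x₁, x₂, x₃] i - ![x₁, x₂, x₃] j| := by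
    rcases h₁ with ⟨h, h'⟩ | ⟨h, h'⟩ | ⟨h, h'⟩
    · refine ⟨0, fun j hj => ?_⟩
      fin_cases j
      exacts [absurd rfl hj, h, h']
    · rw [abs_sub_comm t₁, abs_sub_comm x₁] at h
      refine ⟨1, fun j hj => ?_⟩
      fin_cases j
      exacts [h, absurd rfl hj, h']
    · rw [abs_sub_comm _ t₃, abs_sub_comm _ x₃] at h h'
      refine ⟨2, fun j hj => ?_⟩
      fin_cases j
      exacts [h, h', absurd rfl hj]
  obtain ⟨i, hi⟩ := key
  have := H ![x₁, x₂, x₃] ![t₁, t₂, t₃] {i} (by simp) ⟨i + 1, by simp⟩ r hr (by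
    intro k hk j hj
    obtain rfl : k = i := by simpa using hk
    exact hi j (by simpa using hj))
  refine le_trans (le_of_eq ?_) (this.trans
    (mul_le_mul_of_nonneg_right (le_abs_self C) (by positivity)))
  simp [conn₃, ← S.centre_put, put]

/-- At equal times, connected correlation functions decay with the distance between any two of
the points. -/
theorem ClusteringOf.equal_time {v : ℝ} {n : ℕ} (hn : n ≤ 4) {K : (Fin n → A) → ℂ}
    (h : S.ClusteringOf v n K) {a : Fin n → A} (ha : ∀ i, a i ∈ S.V) :
    ∃ C p : ℝ, 0 ≤ C ∧ 3 < p ∧ ∀ (y : Fin n → ℝ) (i j : Fin n), i ≠ j →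
      ‖K fun i => S.ι (y i) (a i)‖ ≤ C * (1 + |y i - y j| / 3) ^ (-p) := by
  obtain ⟨C, p, hp, H⟩ := h a ha
  refine ⟨|C|, p, abs_nonneg C, hp, fun y i j hij => ?_⟩
  have key : ∃ I : Finset (Fin n), I.Nonempty ∧ Iᶜ.Nonempty ∧
      ∀ k ∈ I, ∀ l ∈ Iᶜ, |y i - y j| / 3 ≤ |y k - y l| := by
    have lt : ∀ i j, y i < y j → ∃ I : Finset (Fin n), I.Nonempty ∧ Iᶜ.Nonempty ∧
      ∀ k ∈ I, ∀ l ∈ Iᶜ, |y i - y j| / 3 ≤ |y k - y l| := by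
      intro i j hlt
      obtain ⟨s, hi, hj, hs⟩ := exists_gap hn y i j hlt
      refine ⟨Finset.univ.filter fun k => y k ≤ s, ⟨i, by simp [hi]⟩, ⟨j, by simp; linarith⟩, ?_⟩
      intro k hk l hl
      simp only [Finset.compl_filter, Finset.mem_filter, Finset.mem_univ, true_and] at hk hl
      have := (hs l).resolve_left hl
      rw [abs_sub_comm (y i), abs_sub_comm (y k), abs_of_pos (by linarith), abs_of_pos (by linarith)]
      linarith
    rcases lt_trichotomy (y i) (y j) with hlt | heq | hlt
    · exact lt i j hlt
    · exact ⟨{i}, by simp, ⟨j, by simpa using hij.symm⟩, fun k _ l _ => by simp [heq]⟩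
    · rw [abs_sub_comm (y i)]
      exact lt j i hlt
  obtain ⟨I, hI, hI', hr⟩ := key
  have := H y (fun _ => 0) I hI hI' (|y i - y j| / 3) (by positivity) (fun k hk l hl =>
    ⟨by simp, hr k hk l hl⟩)
  simp only [S.τ_zero] at this
  exact this.trans (mul_le_mul_of_nonneg_right (le_abs_self C) (by positivity))

end System
end HydroProj

namespace HydroProj

/-! ### Limits of double integrals -/

/-- A family of vectors is continuous when its Gram kernel is. -/
theorem continuous_of_continuous_inner {X H : Type*} [TopologicalSpace X] [NormedAddCommGroup H]
    [InnerProductSpace ℂ H] {f : X → H}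
    (h : Continuous fun p : X × X => inner ℂ (f p.1) (f p.2)) : Continuous f := by
  rw [continuous_iff_continuousAt]
  intro t
  rw [ContinuousAt, tendsto_iff_norm_sub_tendsto_zero]
  have hn : ∀ s, ‖f s - f t‖ ^ 2
      = (inner ℂ (f s) (f s)).re - 2 * (inner ℂ (f s) (f t)).re + (inner ℂ (f t) (f t)).re := by
    intro s
    rw [norm_sub_sq (𝕜 := ℂ), ← inner_self_eq_norm_sq (𝕜 := ℂ) (f s),
      ← inner_self_eq_norm_sq (𝕜 := ℂ) (f t)]
    rfl
  have hc : Continuous fun s => ‖f s - f t‖ ^ 2 := by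
    simp only [hn]
    have h1 := h.comp (f := fun s : X => (s, s)) (by fun_prop)
    have h2 := h.comp (f := fun s : X => (s, t)) (by fun_prop)
    exact ((Complex.continuous_re.comp h1).sub
      (continuous_const.mul (Complex.continuous_re.comp h2))).add continuous_const
  have h1 := (Real.continuous_sqrt.tendsto _).comp (hc.tendsto t)
  simpa [Function.comp_def, Real.sqrt_sq] using h1

theorem tendsto_integral_square_sub {g : ℝ → ℂ} (hg : Integrable g) :
    Tendsto (fun n : ℝ => ((2 * n : ℝ) : ℂ)⁻¹ * ∫ x in (-n)..n, ∫ y in (-n)..n, g (x - y)) atTop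
      (𝓝 (∫ x, g x)) := by
  have lim : Tendsto (fun n : ℝ => ∫ θ in (-1 : ℝ)..1, ∫ u in (n * θ - n)..(n * θ + n), g u) atTop
      (𝓝 (∫ θ in (-1 : ℝ)..1, ∫ x, g x)) := by
    refine intervalIntegral.tendsto_integral_filter_of_dominated_convergence
      (fun _ => ∫ x, ‖g x‖) ?_ ?_ (by simp) ?_
    · refine Eventually.of_forall fun n => ?_
      have hc : Continuous fun u : ℝ => ∫ x in (0 : ℝ)..u, g x :=
        intervalIntegral.continuous_primitive (fun a b => hg.intervalIntegrable) 0
      have : (fun θ : ℝ => ∫ u in (n * θ - n)..(n * θ + n), g u)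
          = fun θ => (∫ x in (0 : ℝ)..(n * θ + n), g x) - ∫ x in (0 : ℝ)..(n * θ - n), g x := by
        ext θ
        rw [intervalIntegral.integral_interval_sub_left hg.intervalIntegrable
          hg.intervalIntegrable]
      rw [this]
      exact ((hc.comp (by fun_prop)).sub (hc.comp (by fun_prop))).aestronglyMeasurable
    · filter_upwards [eventually_gt_atTop 0] with n hn
      refine ae_of_all _ fun θ _ => ?_
      rw [intervalIntegral.integral_of_le (by linarith)]
      exact (norm_integral_le_integral_norm _).trans
        (setIntegral_le_integral hg.norm (ae_of_all _ fun _ => norm_nonneg _))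
    · have hne : ∀ᵐ θ : ℝ, θ ≠ 1 := by simp [ae_iff, measure_singleton]
      filter_upwards [hne] with θ hθ hθ'
      rw [Set.uIoc_of_le (by norm_num)] at hθ'
      have hlt : θ - 1 < 0 := sub_neg.2 (lt_of_le_of_ne hθ'.2 hθ)
      have hgt : 0 < θ + 1 := by linarith [hθ'.1]
      refine intervalIntegral_tendsto_integral hg ?_ ?_
      · refine (tendsto_id.atTop_mul_const_of_neg hlt).congr (fun n => ?_)
        simp; ring
      · refine (tendsto_id.atTop_mul_const hgt).congr (fun n => ?_)
        simp; ring
  have lim' := lim.const_mul ((2 : ℂ)⁻¹)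
  rw [intervalIntegral.integral_const] at lim'
  have e : (2 : ℂ)⁻¹ * ((1 - (-1) : ℝ) • ∫ x, g x) = ∫ x, g x := by
    rw [Complex.real_smul]; push_cast; ring
  rw [e] at lim'
  refine lim'.congr' ?_
  filter_upwards [eventually_gt_atTop 0] with n hn
  have h1 : ∀ x : ℝ, ∫ y in (-n)..n, g (x - y) = ∫ u in (x - n)..(x + n), g u := by
    intro x
    rw [intervalIntegral.integral_comp_sub_left (fun u => g u), sub_neg_eq_add]
  simp only [h1]
  have h2 := intervalIntegral.smul_integral_comp_mul_left (a := -1) (b := 1)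
    (fun x : ℝ => ∫ u in (x - n)..(x + n), g u) n
  rw [mul_neg_one, mul_one] at h2
  rw [← h2, Complex.real_smul]
  have : (n : ℂ) ≠ 0 := by exact_mod_cast hn.ne'
  push_cast
  field_simp

theorem tendsto_integral_square_add {g : ℝ → ℂ} (hg : Integrable g) :
    Tendsto (fun n : ℝ => ((2 * n : ℝ) : ℂ)⁻¹ * ∫ x in (-n)..n, ∫ y in (-n)..n, g (x + y)) atTop
      (𝓝 (∫ x, g x)) := by
  refine (tendsto_integral_square_sub hg).congr fun n => ?_
  congr 2
  ext x
  simp [← sub_eq_add_neg]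

theorem integral_square_add {f g : ℝ → ℝ → ℂ} (hf : Continuous (Function.uncurry f))
    (hg : Continuous (Function.uncurry g)) (n : ℝ) :
    ∫ x in (-n)..n, ∫ y in (-n)..n, (f x y + g x y)
      = (∫ x in (-n)..n, ∫ y in (-n)..n, f x y) + ∫ x in (-n)..n, ∫ y in (-n)..n, g x y := by
  have c := fun (f : ℝ → ℝ → ℂ) (hf : Continuous (Function.uncurry f)) =>
    (intervalIntegral.continuous_parametric_intervalIntegral_of_continuous' (μ := volume) hf
      (-n) n).intervalIntegrable (μ := volume) (-n) n
  rw [← intervalIntegral.integral_add (c f hf) (c g hg)]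
  congr 1
  ext x
  have s : Continuous fun y : ℝ => (x, y) := by fun_prop
  exact intervalIntegral.integral_add ((hf.comp s).intervalIntegrable _ _)
    ((hg.comp s).intervalIntegrable _ _)

/-- The cross-correlation of two functions. -/
def crossCorr (f g : ℝ → ℂ) (s : ℝ) : ℂ := ∫ w, f (s + w) * g w

theorem crossCorr_eq_convolution (f g : ℝ → ℂ) :
    crossCorr f g = convolution (fun t => g (-t)) f (ContinuousLinearMap.mul ℂ ℂ) volume := by
  ext s
  rw [convolution_def, crossCorr, ← integral_neg_eq_self]
  simp [mul_comm, sub_eq_add_neg]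

theorem integrable_crossCorr {f g : ℝ → ℂ} (hf : Integrable f) (hg : Integrable g) :
    Integrable (crossCorr f g) := by
  rw [crossCorr_eq_convolution]
  exact hg.comp_neg.integrable_convolution _ hf

theorem integral_crossCorr {f g : ℝ → ℂ} (hf : Integrable f) (hg : Integrable g) :
    ∫ s, crossCorr f g s = (∫ x, f x) * ∫ x, g x := by
  rw [crossCorr_eq_convolution, integral_convolution _ hg.comp_neg hf, integral_neg_eq_self]
  simp [mul_comm]

theorem integrable_crossCorr_integrand {f g : ℝ → ℂ} {K : ℝ} (hf : Continuous f)
    (hK : ∀ x, ‖f x‖ ≤ K) (hg : Integrable g) (s : ℝ) : Integrable fun w => f (s + w) * g w :=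
  hg.bdd_mul (c := K) (hf.comp (by fun_prop)).aestronglyMeasurable (ae_of_all _ fun _ => hK _)

theorem continuous_crossCorr {f g : ℝ → ℂ} {K : ℝ} (hf : Continuous f) (hK : ∀ x, ‖f x‖ ≤ K)
    (hg : Integrable g) : Continuous (crossCorr f g) := by
  refine continuous_of_dominated (bound := fun w => K * ‖g w‖)
    (fun s => (integrable_crossCorr_integrand hf hK hg s).aestronglyMeasurable) (fun s => ?_)
    (hg.norm.const_mul K) ?_
  · refine ae_of_all _ fun w => ?_
    rw [norm_mul]
    exact mul_le_mul_of_nonneg_right (hK _) (norm_nonneg _)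
  · exact ae_of_all _ fun w => (hf.comp (by fun_prop)).mul continuous_const

namespace System

variable {A : Type*} [Ring A] [StarRing A] [Algebra ℂ A] [StarModule ℂ A] (S : System A)

/-! ### The inner product of `Hhat` -/

theorem mem_nucleus (a : S.V) : (a : A) ∈ S.nucleus :=
  Submodule.subset_span ⟨0, a, a.2, (S.τ_zero _).symm⟩

theorem evolve_cls (t : ℝ) (a : S.V) : S.evolve t (S.cls a)
    = ((Nuc.mk (S.τ t a) (S.evolve_mem t (S.mem_nucleus a)) : S.Nuc) : S.Hhat) :=
  ContinuousLinearMap.completion_apply_coe _ _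

theorem evolve_zero (a : S.V) : S.evolve 0 (S.cls a) = S.cls a := by
  rw [evolve_cls, cls]
  congr 1
  exact Subtype.ext (S.τ_zero _)

theorem inner_cls (a b : S.V) : inner ℂ (S.cls a) (S.cls b) = ∫ x, S.cov a b x :=
  UniformSpace.Completion.inner_coe _ _

theorem inner_cls_evolve (a b : S.V) (t : ℝ) :
    inner ℂ (S.cls a) (S.evolve t (S.cls b)) = ∫ x, S.cov a (S.τ t b) x := by
  rw [evolve_cls]
  exact UniformSpace.Completion.inner_coe _ _

theorem inner_evolve_evolve (a b : S.V) (s t : ℝ) :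
    inner ℂ (S.evolve s (S.cls a)) (S.evolve t (S.cls b)) = ∫ x, S.cov (S.τ (s - t) a) b x := by
  rw [evolve_cls, evolve_cls]
  refine (UniformSpace.Completion.inner_coe _ _).trans ?_
  refine integral_congr_ae (ae_of_all _ fun x => ?_)
  rw [← S.cov_evolve (S.τ (s - t) a) b t x, ← S.τ_add, add_sub_cancel]
  rfl

theorem cls_sub (a b : S.V) : S.cls (a - b) = S.cls a - S.cls b :=
  UniformSpace.Completion.coe_sub (Nuc.mk (a : A) (S.mem_nucleus a) : S.Nuc)
    (Nuc.mk (b : A) (S.mem_nucleus b))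

theorem norm_cls_sq (a : S.V) : ((‖S.cls a‖ ^ 2 : ℝ) : ℂ) = ∫ x, S.cov a a x := by
  rw [← S.inner_cls, inner_self_eq_norm_sq_to_K]
  simp

/-- The standard deviation of an observable. -/
def stdDev (a : A) : ℝ := √(S.ω (star (S.centre a) * S.centre a)).re

theorem norm_ω_star_mul_le (a b : A) :
    ‖S.ω (star a * b)‖ ≤ √(S.ω (star a * a)).re * √(S.ω (star b * b)).re := by
  let c : PreInnerProductSpace.Core ℂ A := S.gnsCore
  let : SeminormedAddCommGroup A := InnerProductSpace.Core.toSeminormedAddCommGroup (𝕜 := ℂ)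
  let : InnerProductSpace ℂ A := InnerProductSpace.ofCore c
  exact norm_inner_le_norm (𝕜 := ℂ) a b

theorem norm_cov_le (a b : A) (x : ℝ) : ‖S.cov a b x‖ ≤ S.stdDev a * S.stdDev b := by
  have e : S.cov a b x = S.ω (star (S.ι x (S.centre a)) * S.centre b) := by
    rw [cov_eq, ← map_star, star_centre]
    simp only [centre, map_sub, sub_mul]
    simp [Algebra.algebraMap_eq_smul_one, S.ω_one]
  rw [e]
  refine (S.norm_ω_star_mul_le _ _).trans (le_of_eq ?_)
  rw [← map_star, ← map_mul, S.ω_ι]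
  rfl

theorem centre_evolve (s : ℝ) (a : A) : S.centre (S.τ s a) = S.τ s (S.centre a) := by
  simp [centre, S.ω_τ, Algebra.algebraMap_eq_smul_one]

theorem stdDev_evolve (t : ℝ) (a : A) : S.stdDev (S.τ t a) = S.stdDev a := by
  rw [stdDev, centre_evolve, ← map_star, ← map_mul, S.ω_τ, stdDev]

theorem cov_eq_put (a b : A) (t x : ℝ) : S.cov (S.τ t a) b x
    = S.ω (S.put x t (S.centre (star a)) * S.put 0 0 (S.centre b)) := by
  rw [cov_eq, put_zero_zero, put, ← map_star]
  conv_rhs => rw [← put, ← centre_put, ω_centre_mul, ω_centre, mul_zero, sub_zero]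

variable {S}

/-- Time evolution is strongly continuous on classes of local observables. -/
theorem continuous_evolve_cls {v : ℝ} (hv : 0 < v) (h : S.ClusteringOf v 2 S.conn₂) (a : S.V) :
    Continuous fun t => S.evolve t (S.cls a) := by
  have hk : Continuous fun t => ∫ x, S.cov (S.τ t a) a x := by
    rw [continuous_iff_continuousAt]
    intro t₀
    obtain ⟨C, p, hC, hp, H⟩ := clustering₂ h (star_mem a.2) a.2
    set M : ℝ := v * (|t₀| + 1) with hM
    have hM0 : 0 ≤ M := by positivity
    set K : ℝ := S.stdDev a * S.stdDev a with hKdef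
    have hK : 0 ≤ K := mul_self_nonneg _
    refine continuousAt_of_dominated
      (bound := fun x => (C + K * (1 + M) ^ p) * (1 + |x|) ^ (-p)) ?_ ?_ ?_ ?_
    · exact Eventually.of_forall fun t => (S.cov_integrable (S.evolve_mem t (S.mem_nucleus a))
        (S.mem_nucleus a)).aestronglyMeasurable
    · filter_upwards [Metric.ball_mem_nhds t₀ one_pos] with t ht
      refine ae_of_all _ fun x => ?_
      have ht' : v * |t| ≤ M := by
        rw [hM]
        have : |t| ≤ |t₀| + 1 := by
          have h1 := abs_sub_abs_le_abs_sub t t₀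
          rw [Metric.mem_ball, Real.dist_eq] at ht
          linarith
        gcongr
      rcases le_or_gt (v * |t|) |x| with hx | hx
      · rw [cov_eq_put]
        have := H x t 0 0 |x| (abs_nonneg x) (by simpa using hx) (by simp)
        refine this.trans ?_
        gcongr
        have : 0 ≤ K * (1 + M) ^ p := by positivity
        linarith
      · refine (S.norm_cov_le _ _ _).trans ?_
        rw [S.stdDev_evolve, ← hKdef]
        have h1 : K = K * (1 + M) ^ p * (1 + M) ^ (-p) := by
          rw [mul_assoc, ← Real.rpow_add (by linarith), add_neg_cancel, Real.rpow_zero, mul_one]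
        have h2 : (1 + M) ^ (-p) ≤ (1 + |x|) ^ (-p) :=
          Real.rpow_le_rpow_of_nonpos (by positivity) (by linarith) (by linarith)
        calc K = K * (1 + M) ^ p * (1 + M) ^ (-p) := h1
          _ ≤ (C + K * (1 + M) ^ p) * (1 + |x|) ^ (-p) := by
            gcongr
            linarith
    · have := integrable_one_add_abs_div (p := p) (k := 1) (by linarith) one_pos
      simp only [div_one] at this
      exact this.const_mul _
    · refine ae_of_all _ fun x => Continuous.continuousAt ?_
      simp only [cov_eq_put]
      exact S.continuous_corr₂ (S.centre_mem (star_mem a.2)) (S.centre_mem a.2) continuous_const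
        continuous_id continuous_const continuous_const
  apply continuous_of_continuous_inner
  simp only [inner_evolve_evolve]
  exact hk.comp (continuous_fst.sub continuous_snd)

/-! ### Bilinear charge densities -/

variable (S) in
/-- The vector `(q(x) q')†`. -/
def bilinearVec (q q' : S.V) (x : ℝ) : S.Hhat := S.cls (star (S.shift x q * q'))

variable {q q' : S.V}

theorem cov_bilinear (hq : star (q : A) = q) (hq' : star (q' : A) = q') (hω : S.ω q = 0)
    (hω' : S.ω q' = 0) (x y z : ℝ) :
    S.cov (star (S.shift x q * q') : S.V) (star (S.shift y q * q') : S.V) z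
      = S.conn₄ ![S.ι (x + z) q, S.ι z q', S.ι 0 q', S.ι y q]
        + S.cov q q' (x + z) * S.cov q' q (z - y) + S.cov q q (x - y + z) * S.cov q' q' z := by
  have e1 : S.ω (S.ι (x + z) q * S.ι y q) = S.ω (S.ι (x - y + z) q * q) := by
    rw [← S.ω_ι y (S.ι (x - y + z) q * q), map_mul (S.ι y), ← S.ι_add]
    congr 4; ring
  have e2 : S.ω (S.ι z q' * S.ι y q) = S.ω (S.ι (z - y) q' * q) := by
    rw [← S.ω_ι y (S.ι (z - y) q' * q), map_mul (S.ι y), ← S.ι_add]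
    congr 4; ring
  have e3 : S.ω (S.ι (x + z) q * S.ι z q') = S.ω (S.ι x q * q') := by
    rw [← S.ω_ι z (S.ι x q * q'), map_mul (S.ι z), ← S.ι_add, add_comm]
  have c1 : ∀ x, S.centre (S.ι x q) = S.ι x q := fun x => S.centre_eq_self (by rw [S.ω_ι, hω])
  have c2 : ∀ x, S.centre (S.ι x q') = S.ι x q' := fun x => S.centre_eq_self (by rw [S.ω_ι, hω'])
  simp only [conn₄, Matrix.cons_val, c1, c2, cov, e1, e2, e3, hω, hω', hq, hq', mul_zero, sub_zero]
  simp only [StarMemClass.coe_star, MulMemClass.coe_mul, shift, star_mul, map_mul,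
    ← S.ι_add, S.ι_zero, ← map_star, hq, hq', mul_assoc, add_comm z x]
  ring

theorem exists_conn₄_bound {v : ℝ} (h : S.ClusteringOf v 4 S.conn₄) (q q' : S.V) :
    ∃ C p : ℝ, 0 ≤ C ∧ 1 < p ∧ ∀ x y z, ‖S.conn₄ ![S.ι (x + z) q, S.ι z q', S.ι 0 q', S.ι y q]‖
      ≤ C * ((1 + |x| / 3) ^ (-p) * ((1 + |y| / 3) ^ (-p) * (1 + |z| / 3) ^ (-p))) := by
  obtain ⟨C, p, hC, hp, H⟩ := h.equal_time le_rfl (a := ![(q : A), q', q', q])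
    (by intro i; fin_cases i <;> simp)
  refine ⟨C, p / 3, hC, by linarith, fun x y z => ?_⟩
  have e : (fun i : Fin 4 => S.ι (![x + z, z, 0, y] i) (![(q : A), q', q', q] i))
      = ![S.ι (x + z) q, S.ι z q', S.ι 0 q', S.ι y q] := by
    ext i; fin_cases i <;> rfl
  have h1 := H ![x + z, z, 0, y] 0 1 (by decide)
  have h2 := H ![x + z, z, 0, y] 3 2 (by decide)
  have h3 := H ![x + z, z, 0, y] 1 2 (by decide)
  rw [e] at h1 h2 h3
  simp only [Matrix.cons_val, add_sub_cancel_right, sub_zero] at h1 h2 h3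
  have one : ∀ w : ℝ, 1 ≤ 1 + |w| / 3 := fun w => by have := abs_nonneg w; linarith
  exact le_mul_rpow_three hC (by linarith) (one x) (one y) (one z) h1 h2 h3

theorem continuous_conn₄ {X : Type*} [TopologicalSpace X] (hω : S.ω q = 0) (hω' : S.ω q' = 0)
    {x₁ x₂ x₃ x₄ : X → ℝ} (hx₁ : Continuous x₁) (hx₂ : Continuous x₂) (hx₃ : Continuous x₃)
    (hx₄ : Continuous x₄) : Continuous fun p =>
      S.conn₄ ![S.ι (x₁ p) q, S.ι (x₂ p) q', S.ι (x₃ p) q', S.ι (x₄ p) q] := by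
  have c1 : ∀ x, S.centre (S.ι x q) = S.ι x q := fun x => S.centre_eq_self (by rw [S.ω_ι, hω])
  have c2 : ∀ x, S.centre (S.ι x q') = S.ι x q' := fun x => S.centre_eq_self (by rw [S.ω_ι, hω'])
  simp only [conn₄, Matrix.cons_val, c1, c2]
  have k2 : ∀ (a b : S.V) {x y : X → ℝ}, Continuous x → Continuous y →
      Continuous fun p => S.ω (S.ι (x p) a * S.ι (y p) b) := by
    intro a b x y hx hy
    refine (S.continuous_corr₂ a.2 b.2 hx (t₁ := fun _ => 0) continuous_const hy (t₂ := fun _ => 0)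
      continuous_const).congr fun p => ?_
    simp only [put, S.τ_zero]
  exact (((S.continuous_corr₄ q.2 q'.2 q'.2 q.2 hx₁ hx₂ hx₃ hx₄).sub
    ((k2 q q' hx₁ hx₂).mul (k2 q' q hx₃ hx₄))).sub
    ((k2 q q' hx₁ hx₃).mul (k2 q' q hx₂ hx₄))).sub ((k2 q q hx₁ hx₄).mul (k2 q' q' hx₂ hx₃))

variable (S) in
/-- The space integral of the connected four-point function in the Gram kernel. -/
def quarticKernel (q q' : S.V) (x y : ℝ) : ℂ :=
  ∫ z, S.conn₄ ![S.ι (x + z) q, S.ι z q', S.ι 0 q', S.ι y q]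

theorem inner_bilinearVec {v : ℝ} (h : S.ClusteringOf v 4 S.conn₄) (hq : star (q : A) = q)
    (hq' : star (q' : A) = q') (hω : S.ω q = 0) (hω' : S.ω q' = 0) (x y : ℝ) :
    inner ℂ (S.bilinearVec q q' x) (S.bilinearVec q q' y) = S.quarticKernel q q' x y
      + crossCorr (S.cov q q') (S.cov q' q) (x + y) + crossCorr (S.cov q q) (S.cov q' q') (x - y) := by
  have hi : ∀ a b : S.V, Integrable (S.cov a b) := fun a b =>
    S.cov_integrable (S.mem_nucleus a) (S.mem_nucleus b)
  have hc : ∀ a b : S.V, Continuous (S.cov a b) := fun a b =>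
    S.cov_continuous (S.mem_nucleus a) (S.mem_nucleus b)
  obtain ⟨C, p, hC, hp, H⟩ := exists_conn₄_bound h q q'
  have i1 : Integrable fun z => S.conn₄ ![S.ι (x + z) q, S.ι z q', S.ι 0 q', S.ι y q] := by
    refine Integrable.mono' ((integrable_one_add_abs_div hp (k := 3) (by norm_num)).const_mul
      (C * ((1 + |x| / 3) ^ (-p) * (1 + |y| / 3) ^ (-p))))
      (continuous_conn₄ hω hω' (by fun_prop) (by fun_prop) (by fun_prop)
        (by fun_prop)).aestronglyMeasurable (ae_of_all _ fun z => ?_)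
    exact (H x y z).trans (le_of_eq (by ring))
  have e2 : ∀ z, S.cov q q' (x + z) * S.cov q' q (z - y)
      = (fun w => S.cov q q' (x + y + w) * S.cov q' q w) (z - y) := by
    intro z; dsimp only; congr 2; ring
  have i2' := integrable_crossCorr_integrand (hc q q') (S.norm_cov_le _ _) (hi q' q) (x + y)
  have i2 : Integrable fun z => S.cov q q' (x + z) * S.cov q' q (z - y) := by
    simp only [e2]
    exact i2'.comp_sub_right y
  have i3 := integrable_crossCorr_integrand (hc q q) (S.norm_cov_le _ _) (hi q' q') (x - y)
  rw [bilinearVec, bilinearVec, inner_cls]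
  simp only [cov_bilinear hq hq' hω hω']
  have e := integral_add (i1.add i2) i3
  simp only [Pi.add_apply] at e
  rw [e, integral_add i1 i2]
  simp only [e2]
  rw [integral_sub_right_eq_self (fun w => S.cov q q' (x + y + w) * S.cov q' q w)]
  rfl

theorem continuous_quarticKernel {v : ℝ} (h : S.ClusteringOf v 4 S.conn₄) (hω : S.ω q = 0)
    (hω' : S.ω q' = 0) : Continuous fun p : ℝ × ℝ => S.quarticKernel q q' p.1 p.2 := by
  obtain ⟨C, p, hC, hp, H⟩ := exists_conn₄_bound h q q'
  refine continuous_of_dominated (bound := fun z => C * (1 + |z| / 3) ^ (-p)) (fun w => ?_)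
    (fun w => ae_of_all _ fun z => ?_) ((integrable_one_add_abs_div hp (by norm_num)).const_mul C)
    (ae_of_all _ fun z => ?_)
  · exact (continuous_conn₄ hω hω' (by fun_prop) (by fun_prop) (by fun_prop)
      (by fun_prop)).aestronglyMeasurable
  · refine (H w.1 w.2 z).trans (mul_le_mul_of_nonneg_left ?_ hC)
    have le1 : ∀ u : ℝ, (1 + |u| / 3) ^ (-p) ≤ 1 := fun u =>
      Real.rpow_le_one_of_one_le_of_nonpos (by have := abs_nonneg u; linarith) (by linarith)
    have nn : ∀ u : ℝ, 0 ≤ (1 + |u| / 3) ^ (-p) := fun u => by positivity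
    exact (mul_le_of_le_one_left (mul_nonneg (nn _) (nn _)) (le1 _)).trans
      (mul_le_of_le_one_left (nn _) (le1 _))
  · exact continuous_conn₄ hω hω' (by fun_prop) (by fun_prop) (by fun_prop) (by fun_prop)

theorem exists_integral_quarticKernel_bound {v : ℝ} (h : S.ClusteringOf v 4 S.conn₄)
    (q q' : S.V) : ∃ M : ℝ, ∀ n : ℝ, 0 ≤ n →
      ‖∫ x in (-n)..n, ∫ y in (-n)..n, S.quarticKernel q q' x y‖ ≤ M := by
  obtain ⟨C, p, hC, hp, H⟩ := exists_conn₄_bound h q q'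
  set φ : ℝ → ℝ := fun x => (1 + |x| / 3) ^ (-p) with hφ
  have iφ : Integrable φ := integrable_one_add_abs_div hp (by norm_num)
  have φ0 : ∀ x, 0 ≤ φ x := fun x => by simp only [hφ]; positivity
  set I := ∫ x, φ x
  have hI : 0 ≤ I := integral_nonneg φ0
  have interval : ∀ (f : ℝ → ℂ) (c n : ℝ), 0 ≤ n → 0 ≤ c → (∀ x, ‖f x‖ ≤ c * φ x) →
      ‖∫ x in (-n)..n, f x‖ ≤ c * I := by
    intro f c n hn hc hf
    rw [intervalIntegral.integral_of_le (by linarith)]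
    refine (norm_integral_le_of_norm_le (iφ.const_mul c).integrableOn
      (ae_of_all _ hf)).trans ?_
    rw [← integral_const_mul]
    exact setIntegral_le_integral (iφ.const_mul c) (ae_of_all _ fun x => mul_nonneg hc (φ0 x))
  have b1 : ∀ x y, ‖S.quarticKernel q q' x y‖ ≤ C * φ x * I * φ y := by
    intro x y
    have := norm_integral_le_of_norm_le (iφ.const_mul (C * (φ x * φ y)))
      (ae_of_all _ fun z => (H x y z).trans (le_of_eq (by simp only [hφ]; ring)))
    rw [integral_const_mul] at this
    exact this.trans (le_of_eq (by ring))
  refine ⟨C * I * I * I, fun n hn => interval _ _ n hn (by positivity) fun x => ?_⟩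
  refine (interval _ (C * φ x * I) n hn ?_ (b1 x)).trans (le_of_eq (by ring))
  have := φ0 x
  positivity

theorem continuous_crossCorr_cov (a b c d : S.V) : Continuous (crossCorr (S.cov a b) (S.cov c d)) :=
  continuous_crossCorr (S.cov_continuous (S.mem_nucleus a) (S.mem_nucleus b)) (S.norm_cov_le _ _)
    (S.cov_integrable (S.mem_nucleus c) (S.mem_nucleus d))

theorem continuous_bilinearVec {v : ℝ} (h : S.ClusteringOf v 4 S.conn₄) (hq : star (q : A) = q)
    (hq' : star (q' : A) = q') (hω : S.ω q = 0) (hω' : S.ω q' = 0) :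
    Continuous (S.bilinearVec q q') := by
  apply continuous_of_continuous_inner
  simp only [inner_bilinearVec h hq hq' hω hω']
  exact ((continuous_quarticKernel h hω hω').add
    ((continuous_crossCorr_cov _ _ _ _).comp (by fun_prop))).add
    ((continuous_crossCorr_cov _ _ _ _).comp (by fun_prop))

theorem inner_integral_left {H : Type*} [NormedAddCommGroup H] [InnerProductSpace ℂ H]
    [CompleteSpace H] {f : ℝ → H} (hf : Continuous f) (a b : ℝ) (ξ : H) :
    inner ℂ (∫ x in a..b, f x) ξ = ∫ x in a..b, inner ℂ (f x) ξ := by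
  have h := (innerSL ℂ ξ).intervalIntegral_comp_comm (μ := volume) (hf.intervalIntegrable a b)
  rw [← inner_conj_symm]
  have h' : inner ℂ ξ (∫ x in a..b, f x) = ∫ x in a..b, inner ℂ ξ (f x) := h.symm
  rw [h', ← intervalIntegral.intervalIntegral_conj]
  simp only [inner_conj_symm]

theorem inner_integral_right {H : Type*} [NormedAddCommGroup H] [InnerProductSpace ℂ H]
    [CompleteSpace H] {f : ℝ → H} (hf : Continuous f) (a b : ℝ) (ξ : H) :
    inner ℂ ξ (∫ x in a..b, f x) = ∫ x in a..b, inner ℂ ξ (f x) :=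
  ((innerSL ℂ ξ).intervalIntegral_comp_comm (μ := volume) (hf.intervalIntegrable a b)).symm

/-- The norm of a bilinear charge grows like the square root of the volume. -/
theorem tendsto_norm_integral_bilinearVec {v : ℝ} (h : S.ClusteringOf v 4 S.conn₄)
    (hq : star (q : A) = q) (hq' : star (q' : A) = q') (hω : S.ω q = 0) (hω' : S.ω q' = 0) :
    Tendsto (fun n : ℝ => ‖∫ x in (-n)..n, S.bilinearVec q q' x‖ ^ 2 / (2 * n)) atTop
      (𝓝 (‖S.cls q‖ ^ 2 * ‖S.cls q'‖ ^ 2 + ‖inner ℂ (S.cls q) (S.cls q')‖ ^ 2)) := by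
  have hi : ∀ a b : S.V, Integrable (S.cov a b) := fun a b =>
    S.cov_integrable (S.mem_nucleus a) (S.mem_nucleus b)
  have hF := continuous_bilinearVec h hq hq' hω hω'
  obtain ⟨M, hM⟩ := exists_integral_quarticKernel_bound h q q'
  have l1 : Tendsto (fun n : ℝ => ((2 * n : ℝ) : ℂ)⁻¹ *
      ∫ x in (-n)..n, ∫ y in (-n)..n, S.quarticKernel q q' x y) atTop (𝓝 0) := by
    have inv : Tendsto (fun n : ℝ => (2 * n)⁻¹ * M) atTop (𝓝 0) := by
      have := (tendsto_inv_atTop_zero.comp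
        (tendsto_id.const_mul_atTop (two_pos (α := ℝ)))).mul_const M
      simpa using this
    refine squeeze_zero_norm' ?_ inv
    filter_upwards [eventually_gt_atTop 0] with n hn
    rw [norm_mul, norm_inv, Complex.norm_real, Real.norm_of_nonneg (by positivity)]
    exact mul_le_mul_of_nonneg_left (hM n hn.le) (by positivity)
  have l2 := tendsto_integral_square_add (integrable_crossCorr (hi q q') (hi q' q))
  have l3 := tendsto_integral_square_sub (integrable_crossCorr (hi q q) (hi q' q'))
  have l := (l1.add l2).add l3
  rw [integral_crossCorr (hi _ _) (hi _ _), integral_crossCorr (hi _ _) (hi _ _), ← norm_cls_sq,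
    ← norm_cls_sq, ← inner_cls, ← inner_cls, zero_add] at l
  have el : inner ℂ (S.cls q) (S.cls q') * inner ℂ (S.cls q') (S.cls q)
      + ((‖S.cls q‖ ^ 2 : ℝ) : ℂ) * ((‖S.cls q'‖ ^ 2 : ℝ) : ℂ)
      = ((‖S.cls q‖ ^ 2 * ‖S.cls q'‖ ^ 2 + ‖inner ℂ (S.cls q) (S.cls q')‖ ^ 2 : ℝ) : ℂ) := by
    rw [← inner_conj_symm (S.cls q') (S.cls q), Complex.mul_conj, Complex.normSq_eq_norm_sq]
    push_cast
    ring
  rw [el] at l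
  have lre := (Complex.continuous_re.tendsto _).comp l
  rw [Complex.ofReal_re] at lre
  refine lre.congr fun n => ?_
  have cC := continuous_quarticKernel h hω hω'
  have c2 : Continuous fun p : ℝ × ℝ => crossCorr (S.cov q q') (S.cov q' q) (p.1 + p.2) :=
    (continuous_crossCorr_cov q q' q' q).comp (by fun_prop)
  have c3 : Continuous fun p : ℝ × ℝ => crossCorr (S.cov q q) (S.cov q' q') (p.1 - p.2) :=
    (continuous_crossCorr_cov q q q' q').comp (by fun_prop)
  have ev : inner ℂ (∫ x in (-n)..n, S.bilinearVec q q' x) (∫ x in (-n)..n, S.bilinearVec q q' x)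
      = (∫ x in (-n)..n, ∫ y in (-n)..n, S.quarticKernel q q' x y)
        + (∫ x in (-n)..n, ∫ y in (-n)..n, crossCorr (S.cov q q') (S.cov q' q) (x + y))
        + ∫ x in (-n)..n, ∫ y in (-n)..n, crossCorr (S.cov q q) (S.cov q' q') (x - y) := by
    rw [inner_integral_left hF]
    simp only [inner_integral_right hF, inner_bilinearVec h hq hq' hω hω']
    rw [integral_square_add (f := fun x y => S.quarticKernel q q' x y
        + crossCorr (S.cov q q') (S.cov q' q) (x + y)) (cC.add c2)
        (g := fun x y => crossCorr (S.cov q q) (S.cov q' q') (x - y)) c3,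
      integral_square_add (f := S.quarticKernel q q') cC
        (g := fun x y => crossCorr (S.cov q q') (S.cov q' q) (x + y)) c2]
  simp only [Function.comp_apply]
  rw [← mul_add, ← mul_add, ← ev, inner_self_eq_norm_sq_to_K, ← Complex.ofReal_inv]
  simp only [Complex.coe_algebraMap]
  rw [← Complex.ofReal_pow, ← Complex.ofReal_mul, Complex.ofReal_re, div_eq_inv_mul]

end System
end HydroProj

namespace HydroProj

theorem norm_integral_strip_sub_le {n : ℝ} (hn : 0 ≤ n) {f g : ℝ → ℝ → ℂ}
    (hf : Integrable (Function.uncurry f) ((volume.restrict (Set.Ioc (-n) n)).prod volume))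
    (hg : Integrable (Function.uncurry g) ((volume.restrict (Set.Ioc (-n) n)).prod volume))
    {B : ℝ → ℝ} (hB : Integrable B)
    (h : ∀ z, ‖(∫ x in (-n)..n, f x z) - ∫ x in (-n)..n, g x z‖ ≤ B z) :
    ‖(∫ x in (-n)..n, ∫ z, f x z) - ∫ x in (-n)..n, ∫ z, g x z‖ ≤ ∫ z, B z := by
  have hle : -n ≤ n := by linarith
  simp only [intervalIntegral.integral_of_le hle] at h ⊢
  have e := integral_sub hf.integral_prod_right hg.integral_prod_right
  simp only [Function.uncurry_apply_pair] at e
  rw [integral_integral_swap hf, integral_integral_swap hg, ← e]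
  exact norm_integral_le_of_norm_le hB (ae_of_all _ h)

theorem integral_sub_integral_sub_const {f g : ℝ → ℂ} (hf : Continuous f) (hg : Continuous g)
    (c : ℂ) (a b : ℝ) : (∫ t in a..b, f t) - ∫ t in a..b, g t
      = (∫ t in a..b, (f t - c)) - ∫ t in a..b, (g t - c) := by
  rw [intervalIntegral.integral_sub (hf.intervalIntegrable _ _) (by simp),
    intervalIntegral.integral_sub (hg.intervalIntegrable _ _) (by simp)]
  ring

theorem tendsto_mul_rpow_atTop_zero {p : ℝ} (hp : 3 < p) (c : ℝ) :
    Tendsto (fun n : ℝ => n * c * (1 + n / 4) ^ (2 - p)) atTop (𝓝 0) := by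
  have h1 : Tendsto (fun n : ℝ => (1 + n / 4) ^ (-(p - 3))) atTop (𝓝 0) :=
    (tendsto_rpow_neg_atTop (by linarith)).comp
      (tendsto_atTop_add_const_left _ _ (tendsto_id.atTop_div_const (by norm_num)))
  have h2 := h1.const_mul (4 * |c|)
  rw [mul_zero] at h2
  refine squeeze_zero_norm' ?_ h2
  filter_upwards [eventually_ge_atTop 0] with n hn
  have hpos : 0 < 1 + n / 4 := by linarith
  have e : (1 + n / 4) ^ (-(p - 3)) = (1 + n / 4) * (1 + n / 4) ^ (2 - p) := by
    nth_rewrite 2 [← Real.rpow_one (1 + n / 4)]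
    rw [← Real.rpow_add hpos]
    congr 1
    ring
  rw [e, norm_mul, norm_mul, Real.norm_of_nonneg hn, Real.norm_eq_abs c,
    Real.norm_of_nonneg (Real.rpow_nonneg hpos.le _)]
  have h3 : 0 ≤ |c| * (1 + n / 4) ^ (2 - p) := by positivity
  nlinarith

namespace System

variable {A : Type*} [Ring A] [StarRing A] [Algebra ℂ A] [StarModule ℂ A] {S : System A}

/-! ### Conservation laws within three-point functions -/

theorem IsConserved.law_left {q j : S.V} (h : S.IsConserved q j) (b c : S.V)
    (z s x₁ x₂ t₁ t₂ : ℝ) :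
    (∫ x in x₁..x₂, S.ω (S.put x t₂ q * S.put z s b * S.put 0 0 c))
        - (∫ x in x₁..x₂, S.ω (S.put x t₁ q * S.put z s b * S.put 0 0 c))
      = (∫ t in t₁..t₂, S.ω (S.put x₁ t (S.centre j) * S.put z s b * S.put 0 0 c))
        - ∫ t in t₁..t₂, S.ω (S.put x₂ t (S.centre j) * S.put z s b * S.put 0 0 c) := by
  have law := h.law [] [(b, z, s), (c, 0, 0)] x₁ x₂ t₁ t₂
  simp only [prodAt, List.nil_append, List.map_cons, List.map_nil, List.prod_cons, List.prod_nil,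
    mul_one, ← mul_assoc] at law
  have hc : ∀ x : ℝ, Continuous fun t => S.ω (S.put x t j * S.put z s b * S.put 0 0 c) := fun x =>
    S.continuous_corr₃ j.2 b.2 c.2 continuous_const continuous_id continuous_const continuous_const
      continuous_const continuous_const
  have key := integral_sub_integral_sub_const (hc x₁) (hc x₂)
    (S.ω j * S.ω (S.put z s b * S.put 0 0 c)) t₁ t₂
  have e : ∀ x t, S.ω (S.put x t (S.centre j) * S.put z s b * S.put 0 0 c)
      = S.ω (S.put x t j * S.put z s b * S.put 0 0 c)
        - S.ω j * S.ω (S.put z s b * S.put 0 0 c) := by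
    intro x t
    rw [← centre_put, mul_assoc, ω_centre_mul, ω_put, mul_assoc]
  simp only [e]
  rw [← key]
  linear_combination law

theorem IsConserved.law_middle {q j : S.V} (h : S.IsConserved q j) (b c : S.V)
    (z s x₁ x₂ t₁ t₂ : ℝ) :
    (∫ x in x₁..x₂, S.ω (S.put z s b * S.put x t₂ q * S.put 0 0 c))
        - (∫ x in x₁..x₂, S.ω (S.put z s b * S.put x t₁ q * S.put 0 0 c))
      = (∫ t in t₁..t₂, S.ω (S.put z s b * S.put x₁ t (S.centre j) * S.put 0 0 c))
        - ∫ t in t₁..t₂, S.ω (S.put z s b * S.put x₂ t (S.centre j) * S.put 0 0 c) := by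
  have law := h.law [(b, z, s)] [(c, 0, 0)] x₁ x₂ t₁ t₂
  simp only [prodAt, List.cons_append, List.nil_append, List.map_cons, List.map_nil,
    List.prod_cons, List.prod_nil, mul_one, ← mul_assoc] at law
  have hc : ∀ x : ℝ, Continuous fun t => S.ω (S.put z s b * S.put x t j * S.put 0 0 c) := fun x =>
    S.continuous_corr₃ b.2 j.2 c.2 continuous_const continuous_const continuous_const continuous_id
      continuous_const continuous_const
  have key := integral_sub_integral_sub_const (hc x₁) (hc x₂)
    (S.ω j * S.ω (S.put z s b * S.put 0 0 c)) t₁ t₂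
  have e : ∀ x t, S.ω (S.put z s b * S.put x t (S.centre j) * S.put 0 0 c)
      = S.ω (S.put z s b * S.put x t j * S.put 0 0 c)
        - S.ω j * S.ω (S.put z s b * S.put 0 0 c) := by
    intro x t
    rw [← centre_put, centre, ω_put]
    simp [mul_sub, sub_mul, Algebra.algebraMap_eq_smul_one]
  simp only [e]
  rw [← key]
  linear_combination law

/-- Two observables at distance `n`, both at times at most `n / 2v`, cannot both be inside the
light cone of a third one. -/
theorem exists_flux_bound {v : ℝ} (hv : 0 < v) (h : S.ClusteringOf v 3 S.conn₃) (a b c : S.V) :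
    ∃ C p : ℝ, 0 ≤ C ∧ 3 < p ∧ ∀ n x₁ t₁ x₂ t₂ w : ℝ, |x₁ - x₂| = n → 2 * v * |t₁| ≤ n →
      2 * v * |t₂| ≤ n → w = x₁ ∨ w = x₂ →
      ‖S.ω (S.put x₁ t₁ (S.centre a) * S.put x₂ t₂ (S.centre b) * S.put 0 0 (S.centre c))‖
        ≤ C * (1 + n / 4) ^ (2 - p) * (1 + |w| / 4) ^ (-2 : ℝ) := by
  obtain ⟨C, p, hC, hp, H⟩ := clustering₃ h a.2 b.2 c.2
  refine ⟨C, p, hC, hp, fun n x₁ t₁ x₂ t₂ w hn h₁ h₂ hw => ?_⟩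
  have hn0 : 0 ≤ n := hn ▸ abs_nonneg _
  have h12 : v * |t₁ - t₂| ≤ n := by
    have := abs_sub t₁ t₂
    nlinarith
  have hx12 := abs_sub_abs_le_abs_sub x₁ x₂
  have hx21 := abs_sub_abs_le_abs_sub x₂ x₁
  have hxs : n ≤ |x₁| + |x₂| := hn ▸ abs_sub x₁ x₂
  rw [abs_sub_comm x₂ x₁, hn] at hx21
  rw [hn] at hx12
  have hws : |w| ≤ |x₁| + n ∧ |w| ≤ |x₂| + n := by
    rcases hw with rfl | rfl <;> constructor <;> linarith
  have hm : ‖S.ω (S.put x₁ t₁ (S.centre a) * S.put x₂ t₂ (S.centre b) * S.put 0 0 (S.centre c))‖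
      ≤ C * (1 + max n |w| / 4) ^ (-p) := by
    have hm1 : n ≤ max n |w| := le_max_left _ _
    refine H x₁ t₁ x₂ t₂ 0 0 (max n |w| / 4) (by positivity) ?_
    simp only [sub_zero, hn]
    rcases le_or_gt (2 * n) |w| with hbig | hsmall
    · rw [max_eq_right (by linarith)]
      exact Or.inr (Or.inr ⟨⟨by linarith, by linarith⟩, by linarith, by linarith⟩)
    · have hm2 : max n |w| ≤ 2 * n := max_le (by linarith) hsmall.le
      rcases le_total (n / 2) |x₁| with hx | hx
      · exact Or.inl ⟨⟨h12, by linarith⟩, by linarith, by linarith⟩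
      · exact Or.inr (Or.inl ⟨⟨h12, by linarith⟩, by linarith, by linarith⟩)
  have hpos : 0 < 1 + max n |w| / 4 := by positivity
  have e : (1 + max n |w| / 4) ^ (-p)
      = (1 + max n |w| / 4) ^ (2 - p) * (1 + max n |w| / 4) ^ (-2 : ℝ) := by
    rw [← Real.rpow_add hpos]
    congr 1
    ring
  have k1 : (1 + max n |w| / 4) ^ (2 - p) ≤ (1 + n / 4) ^ (2 - p) :=
    Real.rpow_le_rpow_of_nonpos (by positivity) (by gcongr; exact le_max_left _ _) (by linarith)
  have k2 : (1 + max n |w| / 4) ^ (-2 : ℝ) ≤ (1 + |w| / 4) ^ (-2 : ℝ) :=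
    Real.rpow_le_rpow_of_nonpos (by positivity) (by gcongr; exact le_max_right _ _) (by norm_num)
  refine hm.trans ?_
  rw [e, mul_assoc]
  gcongr

theorem integrable_strip {v : ℝ} (hv : 0 < v) (h : S.ClusteringOf v 3 S.conn₃) (a b c : S.V)
    {n : ℝ} (hn : 0 ≤ n) (t₁ t₂ : ℝ) {α β : ℝ → ℝ} (hα : Continuous α) (hβ : Continuous β)
    (hαn : ∀ x ∈ Set.Icc (-n) n, |α x| ≤ n) (hβn : ∀ x ∈ Set.Icc (-n) n, |β x| ≤ n) :
    Integrable (Function.uncurry fun x z => S.ω (S.put (α x + z) t₁ (S.centre a)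
      * S.put (β x + z) t₂ (S.centre b) * S.put 0 0 (S.centre c)))
      ((volume.restrict (Set.Ioc (-n) n)).prod volume) := by
  set f : ℝ × ℝ → ℂ := Function.uncurry fun x z => S.ω (S.put (α x + z) t₁ (S.centre a)
      * S.put (β x + z) t₂ (S.centre b) * S.put 0 0 (S.centre c)) with hf
  have hfc : Continuous f :=
    S.continuous_corr₃ (S.centre_mem a.2) (S.centre_mem b.2) (S.centre_mem c.2)
      (x₁ := fun p : ℝ × ℝ => α p.1 + p.2) (x₂ := fun p : ℝ × ℝ => β p.1 + p.2)
      (by fun_prop) continuous_const (by fun_prop) continuous_const continuous_const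
      continuous_const
  obtain ⟨C, p, hC, hp, H⟩ := clustering₃ h a.2 b.2 c.2
  set Z : ℝ := 2 * (n + v * (|t₁| + |t₂|)) with hZ
  obtain ⟨K, hK⟩ := ((isCompact_Icc (a := -n) (b := n)).prod
    (isCompact_Icc (a := -Z) (b := Z))).exists_bound_of_continuousOn hfc.continuousOn
  have hZ0 : 0 ≤ Z := by positivity
  have hg : Integrable (fun q : ℝ × ℝ => (C + |K| * (1 + Z / 2) ^ p) * (1 + |q.2| / 2) ^ (-p))
      ((volume.restrict (Set.Ioc (-n) n)).prod volume) :=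
    (integrable_const (μ := volume.restrict (Set.Ioc (-n) n)) _).mul_prod
      (integrable_one_add_abs_div (p := p) (k := 2) (by linarith) (by norm_num))
  refine Integrable.mono' hg hfc.aestronglyMeasurable ?_
  have hmem : ∀ᵐ q ∂((volume.restrict (Set.Ioc (-n) n)).prod (volume : Measure ℝ)),
      q.1 ∈ Set.Ioc (-n) n :=
    Measure.quasiMeasurePreserving_fst.ae (ae_restrict_mem measurableSet_Ioc)
  filter_upwards [hmem] with q hq
  have hq' : q.1 ∈ Set.Icc (-n) n := Set.Ioc_subset_Icc_self hq
  have hvt₁ : 0 ≤ v * |t₁| := by positivity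
  have hvt₂ : 0 ≤ v * |t₂| := by positivity
  rcases le_or_gt Z |q.2| with hz | hz
  · have hpos : ∀ γ : ℝ, |γ| ≤ n → |q.2| / 2 ≤ |γ + q.2| ∧ v * |t₁| ≤ |γ + q.2|
        ∧ v * |t₂| ≤ |γ + q.2| := by
      intro γ hγ
      have h1 : |q.2| ≤ |γ + q.2| + |γ| := by
        have := abs_sub (γ + q.2) γ
        rwa [add_sub_cancel_left] at this
      refine ⟨?_, ?_, ?_⟩ <;> nlinarith
    obtain ⟨a1, a2, -⟩ := hpos _ (hαn _ hq')
    obtain ⟨b1, -, b3⟩ := hpos _ (hβn _ hq')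
    refine (H (α q.1 + q.2) t₁ (β q.1 + q.2) t₂ 0 0 (|q.2| / 2) (by positivity) (Or.inr (Or.inr ?_))
      ).trans ?_
    · simp only [sub_zero]
      exact ⟨⟨a2, a1⟩, b3, b1⟩
    · gcongr
      have : 0 ≤ |K| * (1 + Z / 2) ^ p := by positivity
      linarith
  · have h1 : |K| = |K| * (1 + Z / 2) ^ p * (1 + Z / 2) ^ (-p) := by
      rw [mul_assoc, ← Real.rpow_add (by positivity), add_neg_cancel, Real.rpow_zero, mul_one]
    have h2 : (1 + Z / 2) ^ (-p) ≤ (1 + |q.2| / 2) ^ (-p) :=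
      Real.rpow_le_rpow_of_nonpos (by positivity) (by linarith) (by linarith)
    calc ‖f q‖ ≤ K := hK q ⟨hq', abs_le.1 hz.le⟩
      _ ≤ |K| := le_abs_self K
      _ = |K| * (1 + Z / 2) ^ p * (1 + Z / 2) ^ (-p) := h1
      _ ≤ (C + |K| * (1 + Z / 2) ^ p) * (1 + |q.2| / 2) ^ (-p) := by
        gcongr
        linarith

theorem cov_bilinear_evolve (q q' a : S.V) (x z t : ℝ) :
    S.cov (star (S.shift x q * q') : S.V) (S.τ t a) z
      = S.ω (S.put (x + z) (-t) q * S.put z (-t) q' * S.put 0 0 (S.centre a)) := by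
  have e : S.centre (S.τ t a) = S.put 0 t (S.centre a) := by
    rw [← centre_put, put, S.ι_zero]
  rw [cov_eq, e, ← S.ω_put 0 (-t) (_ * _), put_mul, put_put]
  simp only [StarMemClass.coe_star, MulMemClass.coe_mul, shift, star_star, map_mul, put,
    ← S.ι_τ_comm, ← S.ι_add]
  simp [add_comm]

/-- Bilinear charges are conserved, up to the finite size of the region in which the charges are
taken to be close to each other. -/
theorem exists_evolve_bilinear_bound {v : ℝ} (hv : 0 < v) (h : S.Clustering v)
    {q j q' j' : S.V} (hq : S.IsConserved q j) (hq' : S.IsConserved q' j') (a : S.V) :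
    ∃ ε : ℝ → ℝ, Tendsto ε atTop (𝓝 0) ∧ ∀ n t, 0 ≤ n → 2 * v * |t| ≤ n →
      ‖inner ℂ (∫ x in (-n)..n, S.bilinearVec q q' x) (S.evolve t (S.cls a))
        - inner ℂ (∫ x in (-n)..n, S.bilinearVec q q' x) (S.cls a)‖ ≤ ε n := by
  obtain ⟨C₁, p₁, hC₁, hp₁, H₁⟩ := exists_flux_bound hv h.2.1 j q' a
  obtain ⟨C₂, p₂, hC₂, hp₂, H₂⟩ := exists_flux_bound hv h.2.1 q j' a
  have hF := continuous_bilinearVec h.2.2 hq.star_eq hq'.star_eq hq.average_eq_zero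
    hq'.average_eq_zero
  set I := ∫ z : ℝ, (1 + |z| / 4) ^ (-2 : ℝ) with hI
  have iφ : Integrable fun z : ℝ => (1 + |z| / 4) ^ (-2 : ℝ) :=
    integrable_one_add_abs_div (by norm_num) (by norm_num)
  have hI0 : 0 ≤ I := integral_nonneg fun z => by positivity
  refine ⟨fun n => n * (v⁻¹ * C₁ * I) * (1 + n / 4) ^ (2 - p₁)
    + n * (v⁻¹ * C₂ * I) * (1 + n / 4) ^ (2 - p₂), ?_, ?_⟩
  · simpa using (tendsto_mul_rpow_atTop_zero hp₁ (v⁻¹ * C₁ * I)).add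
      (tendsto_mul_rpow_atTop_zero hp₂ (v⁻¹ * C₂ * I))
  intro n t hn ht
  set c : S.V := ⟨S.centre a, S.centre_mem a.2⟩ with hc
  set f : ℝ → ℝ → ℝ → ℝ → ℂ := fun y s z s' => S.ω (S.put y s q * S.put z s' q' * S.put 0 0 c)
    with hf
  have cq : S.centre q = q := S.centre_eq_self hq.average_eq_zero
  have cq' : S.centre q' = q' := S.centre_eq_self hq'.average_eq_zero
  have int1 : ∀ s s', Integrable (Function.uncurry fun x z => f (x + z) s z s')
      ((volume.restrict (Set.Ioc (-n) n)).prod volume) := by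
    intro s s'
    have := integrable_strip hv h.2.1 q q' a hn s s' (α := fun x => x) (β := fun _ => 0)
      continuous_id continuous_const (fun x hx => abs_le.2 hx) (fun x _ => by simpa using hn)
    simpa only [zero_add, cq, cq'] using this
  have int2 : ∀ s s', Integrable (Function.uncurry fun x y => f y s (y - x) s')
      ((volume.restrict (Set.Ioc (-n) n)).prod volume) := by
    intro s s'
    have := integrable_strip hv h.2.1 q q' a hn s s' (α := fun _ => 0) (β := fun x => -x)
      continuous_const continuous_neg (fun x _ => by simpa using hn)
      (fun x hx => by rw [abs_neg]; exact abs_le.2 hx)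
    simpa only [zero_add, cq, cq', neg_add_eq_sub] using this
  have val : ∀ t, inner ℂ (∫ x in (-n)..n, S.bilinearVec q q' x) (S.evolve t (S.cls a))
      = ∫ x in (-n)..n, ∫ z, f (x + z) (-t) z (-t) := by
    intro t
    rw [inner_integral_left hF]
    simp only [bilinearVec, inner_cls_evolve, cov_bilinear_evolve]
    rfl
  set s := -t with hs
  have hts : 2 * v * |s| ≤ n := by rwa [hs, abs_neg]
  have hsn : |s| ≤ v⁻¹ * n / 2 := by
    rw [inv_mul_eq_div, div_div, le_div_iff₀ (by positivity)]
    linarith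
  have flux : ∀ (J₁ J₂ : ℝ → ℂ) (B : ℝ), (∀ u ∈ Set.uIoc 0 s, ‖J₁ u‖ ≤ B) →
      (∀ u ∈ Set.uIoc 0 s, ‖J₂ u‖ ≤ B) →
      ‖(∫ u in (0 : ℝ)..s, J₁ u) - ∫ u in (0 : ℝ)..s, J₂ u‖ ≤ 2 * |s| * B := by
    intro J₁ J₂ B h1 h2
    have k1 := intervalIntegral.norm_integral_le_of_norm_le_const h1
    have k2 := intervalIntegral.norm_integral_le_of_norm_le_const h2
    have k3 := norm_sub_le (∫ u in (0 : ℝ)..s, J₁ u) (∫ u in (0 : ℝ)..s, J₂ u)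
    rw [sub_zero] at k1 k2
    linarith
  have hu : ∀ u ∈ Set.uIoc 0 s, 2 * v * |u| ≤ n := by
    intro u hu
    have : |u| ≤ |s| := by
      have h1 := Set.abs_sub_left_of_mem_uIcc (Set.uIoc_subset_uIcc hu)
      simpa using h1
    have : 2 * v * |u| ≤ 2 * v * |s| := by gcongr
    linarith
  have final : ∀ C p : ℝ, 0 ≤ C → ∫ z, 2 * |s| * (C * (1 + n / 4) ^ (2 - p) * (1 + |z| / 4) ^ (-2 : ℝ))
      ≤ n * (v⁻¹ * C * I) * (1 + n / 4) ^ (2 - p) := by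
    intro C p hC
    rw [integral_const_mul, integral_const_mul, ← hI]
    have : 0 ≤ C * (1 + n / 4) ^ (2 - p) * I := by positivity
    nlinarith
  have d1 : ‖(∫ x in (-n)..n, ∫ z, f (x + z) s z s) - ∫ x in (-n)..n, ∫ z, f (x + z) 0 z s‖
      ≤ n * (v⁻¹ * C₁ * I) * (1 + n / 4) ^ (2 - p₁) := by
    refine le_trans (norm_integral_strip_sub_le hn (int1 s s) (int1 0 s)
      (B := fun z => 2 * |s| * (C₁ * (1 + n / 4) ^ (2 - p₁) * (1 + |z| / 4) ^ (-2 : ℝ)))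
      ((iφ.const_mul _).const_mul _) fun z => ?_) (final C₁ p₁ hC₁)
    rw [intervalIntegral.integral_comp_add_right (fun y => f y s z s),
      intervalIntegral.integral_comp_add_right (fun y => f y 0 z s),
      hq.law_left q' c z s (-n + z) (n + z) 0 s]
    refine flux _ _ _ (fun u hu' => ?_) (fun u hu' => ?_)
    · have := H₁ n (-n + z) u z s z (by simp [abs_of_nonneg hn]) (hu u hu') hts (Or.inr rfl)
      rwa [cq'] at this
    · have := H₁ n (n + z) u z s z (by simp [abs_of_nonneg hn]) (hu u hu') hts (Or.inr rfl)
      rwa [cq'] at this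
  have d2 : ‖(∫ x in (-n)..n, ∫ z, f (x + z) 0 z s) - ∫ x in (-n)..n, ∫ z, f (x + z) 0 z 0‖
      ≤ n * (v⁻¹ * C₂ * I) * (1 + n / 4) ^ (2 - p₂) := by
    have tr : ∀ x s, ∫ z, f (x + z) 0 z s = ∫ y, f y 0 (y - x) s := by
      intro x s
      rw [← integral_sub_right_eq_self (fun z => f (x + z) 0 z s) x]
      simp only [add_sub_cancel]
    simp only [tr]
    refine le_trans (norm_integral_strip_sub_le hn (int2 0 s) (int2 0 0)
      (B := fun z => 2 * |s| * (C₂ * (1 + n / 4) ^ (2 - p₂) * (1 + |z| / 4) ^ (-2 : ℝ)))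
      ((iφ.const_mul _).const_mul _) fun y => ?_) (final C₂ p₂ hC₂)
    rw [intervalIntegral.integral_comp_sub_left (fun z => f y 0 z s),
      intervalIntegral.integral_comp_sub_left (fun z => f y 0 z 0),
      hq'.law_middle q c y 0 (y - n) (y - -n) 0 s]
    refine flux _ _ _ (fun u hu' => ?_) (fun u hu' => ?_)
    · have := H₂ n y 0 (y - n) u y (by simp [abs_of_nonneg hn]) (by simpa using hn) (hu u hu')
        (Or.inl rfl)
      rwa [cq] at this
    · have := H₂ n y 0 (y - -n) u y (by simp [abs_of_nonneg hn]) (by simpa using hn) (hu u hu')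
        (Or.inl rfl)
      rwa [cq] at this
  rw [← S.evolve_zero a, val 0]
  have e0 : S.evolve t (S.evolve 0 (S.cls a)) = S.evolve t (S.cls a) := by rw [S.evolve_zero]
  rw [e0, val t, neg_zero]
  calc _ = ‖((∫ x in (-n)..n, ∫ z, f (x + z) s z s) - ∫ x in (-n)..n, ∫ z, f (x + z) 0 z s)
        + ((∫ x in (-n)..n, ∫ z, f (x + z) 0 z s) - ∫ x in (-n)..n, ∫ z, f (x + z) 0 z 0)‖ := by
        rw [sub_add_sub_cancel]
    _ ≤ _ := (norm_add_le _ _).trans (add_le_add d1 d2)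

end System
end HydroProj

namespace HydroProj
namespace System

variable {A : Type*} [Ring A] [StarRing A] [Algebra ℂ A] [StarModule ℂ A] {S : System A}

/-! ### The projection onto the ballistic space -/

theorem norm_evolve (t : ℝ) (ξ : S.Hhat) : ‖S.evolve t ξ‖ = ‖ξ‖ := by
  induction ξ using UniformSpace.Completion.induction_on with
  | hp => exact isClosed_eq (S.evolve t).continuous.norm continuous_norm
  | ih a =>
    have : S.evolve t (a : S.Hhat) = ((S.evolveNuc t a : S.Nuc) : S.Hhat) :=
      ContinuousLinearMap.completion_apply_coe _ _
    rw [this, UniformSpace.Completion.norm_coe, UniformSpace.Completion.norm_coe]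
    exact (S.evolveNuc t).norm_map a

theorem inner_evolve (t : ℝ) (ξ η : S.Hhat) :
    inner ℂ (S.evolve t ξ) (S.evolve t η) = inner ℂ ξ η :=
  LinearIsometry.inner_map_map (⟨(S.evolve t : S.Hhat →ₗ[ℂ] S.Hhat), norm_evolve t⟩ :
    S.Hhat →ₗᵢ[ℂ] S.Hhat) ξ η

theorem evolve_eq_of_mem_ballistic {ξ : S.Hhat} (h : ξ ∈ S.ballistic) (t : ℝ) :
    S.evolve t ξ = ξ := by
  have := (Submodule.mem_iInf _).1 h t
  simpa [sub_eq_zero] using this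

theorem starProjection_evolve (t : ℝ) (ξ : S.Hhat) :
    S.ballistic.starProjection (S.evolve t ξ) = S.ballistic.starProjection ξ := by
  refine Submodule.eq_starProjection_of_mem_of_inner_eq_zero
    (Submodule.starProjection_apply_mem _ _) fun w hw => ?_
  have h1 : inner ℂ (S.evolve t ξ) w = inner ℂ ξ w := by
    nth_rewrite 1 [← evolve_eq_of_mem_ballistic hw t]
    exact inner_evolve t ξ w
  rw [inner_sub_left, h1, ← inner_sub_left]
  exact Submodule.starProjection_inner_eq_zero _ _ hw

theorem coProj_evolve (t : ℝ) (ξ : S.Hhat) :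
    S.coProj (S.evolve t ξ) = S.evolve t ξ - S.ballistic.starProjection ξ := by
  rw [← starProjection_evolve t ξ]
  rfl

theorem coProj_apply (ξ : S.Hhat) : S.coProj ξ = ξ - S.ballistic.starProjection ξ := rfl

/-! ### The lower bound on the Onsager coefficient -/

theorem div_le_liminf {z : ℂ} {D : ℝ} {Z : ℝ → ℂ} {w s : ℝ → ℝ} (hZ : Tendsto Z atTop (𝓝 z))
    (hw : Tendsto w atTop (𝓝 D)) (hle : ∀ᶠ T in atTop, 0 ≤ w T ∧ ‖Z T‖ ^ 2 ≤ s T * w T) :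
    ENNReal.ofReal (‖z‖ ^ 2) / ENNReal.ofReal D
      ≤ liminf (fun T => ENNReal.ofReal (s T)) atTop := by
  rcases eq_or_ne z 0 with rfl | hz
  · simp
  have hz' : ENNReal.ofReal (‖z‖ ^ 2) ≠ 0 := by
    rw [ne_eq, ENNReal.ofReal_eq_zero, not_le]
    positivity
  have hlim : Tendsto (fun T => ENNReal.ofReal (‖Z T‖ ^ 2) / ENNReal.ofReal (w T)) atTop
      (𝓝 (ENNReal.ofReal (‖z‖ ^ 2) / ENNReal.ofReal D)) :=
    ENNReal.Tendsto.div (ENNReal.tendsto_ofReal (hZ.norm.pow 2)) (Or.inl hz')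
      (ENNReal.tendsto_ofReal hw) (Or.inr ENNReal.ofReal_ne_top)
  rw [← hlim.liminf_eq]
  refine liminf_le_liminf ?_
  filter_upwards [hle] with T ⟨hwT, hT⟩
  refine ENNReal.div_le_of_le_mul ?_
  rw [← ENNReal.ofReal_mul' hwT]
  exact ENNReal.ofReal_le_ofReal hT

theorem diffusionBound_of_clustering {v : ℝ} (hv : 0 < v) (h : S.Clustering v)
    {q j q' j' : S.V} (hq : S.IsConserved q j) (hq' : S.IsConserved q' j') :
    S.DiffusionBound q q' v := by
  intro a z hz
  have hF := continuous_bilinearVec h.2.2 hq.star_eq hq'.star_eq hq.average_eq_zero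
    hq'.average_eq_zero
  have hE : Continuous fun t => S.coProj (S.evolve t (S.cls a)) :=
    S.coProj.continuous.comp (continuous_evolve_cls hv h.1 a)
  obtain ⟨ε, hε, Hε⟩ := exists_evolve_bilinear_bound hv h hq hq' a
  set ξ := S.cls a with hξ
  set W : ℝ → S.Hhat := fun n => ∫ x in (-n)..n, S.bilinearVec q q' x with hW
  set O : ℝ → S.Hhat := fun T => ∫ t in (-T)..T, S.coProj (S.evolve t ξ) with hO
  have hN := tendsto_norm_integral_bilinearVec h.2.2 hq.star_eq hq'.star_eq hq.average_eq_zero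
    hq'.average_eq_zero
  have scale : Tendsto (fun T : ℝ => 2 * v * T) atTop atTop :=
    tendsto_id.const_mul_atTop (by positivity)
  have hζ : Tendsto (fun T => inner ℂ (W (2 * v * T)) (S.coProj ξ)) atTop (𝓝 z) := by
    refine (hz.comp scale).congr fun T => ?_
    exact (inner_integral_left hF _ _ _).symm
  have hdiff : ∀ᶠ T in atTop, ‖((2 * T : ℝ) : ℂ)⁻¹ * inner ℂ (W (2 * v * T)) (O T)
      - inner ℂ (W (2 * v * T)) (S.coProj ξ)‖ ≤ ε (2 * v * T) := by
    filter_upwards [eventually_gt_atTop 0] with T hT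
    have hc : Continuous fun t => inner ℂ (W (2 * v * T)) (S.coProj (S.evolve t ξ)) :=
      continuous_const.inner hE
    have e1 : inner ℂ (W (2 * v * T)) (O T)
        - ((2 * T : ℝ) : ℂ) * inner ℂ (W (2 * v * T)) (S.coProj ξ)
        = ∫ t in (-T)..T, (inner ℂ (W (2 * v * T)) (S.coProj (S.evolve t ξ))
          - inner ℂ (W (2 * v * T)) (S.coProj ξ)) := by
      rw [intervalIntegral.integral_sub (hc.intervalIntegrable _ _) (by simp),
        intervalIntegral.integral_const, ← inner_integral_right hE, Complex.real_smul]
      congr 3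
      ring
    have e2 : ‖inner ℂ (W (2 * v * T)) (O T)
        - ((2 * T : ℝ) : ℂ) * inner ℂ (W (2 * v * T)) (S.coProj ξ)‖ ≤ ε (2 * v * T) * (2 * T) := by
      rw [e1]
      refine (intervalIntegral.norm_integral_le_of_norm_le_const (C := ε (2 * v * T))
        fun t ht => ?_).trans (le_of_eq ?_)
      · rw [Set.uIoc_of_le (by linarith)] at ht
        have hab : |t| ≤ T := abs_le.2 ⟨ht.1.le, ht.2⟩
        rw [coProj_evolve, coProj_apply, inner_sub_right, inner_sub_right, sub_sub_sub_cancel_right]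
        exact Hε _ t (by positivity) (by gcongr)
      · rw [sub_neg_eq_add, abs_of_pos (by linarith)]
        ring
    have hne : ((2 * T : ℝ) : ℂ) ≠ 0 := by
      have : (2 * T : ℝ) ≠ 0 := by positivity
      exact_mod_cast this
    have e3 : ((2 * T : ℝ) : ℂ)⁻¹ * inner ℂ (W (2 * v * T)) (O T)
        - inner ℂ (W (2 * v * T)) (S.coProj ξ) = ((2 * T : ℝ) : ℂ)⁻¹ *
          (inner ℂ (W (2 * v * T)) (O T)
            - ((2 * T : ℝ) : ℂ) * inner ℂ (W (2 * v * T)) (S.coProj ξ)) := by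
      rw [mul_sub, inv_mul_cancel_left₀ hne]
    rw [e3, norm_mul, norm_inv, Complex.norm_real, Real.norm_of_nonneg (by positivity),
      inv_mul_le_iff₀ (by positivity)]
    linarith
  have hZ : Tendsto (fun T => ((2 * T : ℝ) : ℂ)⁻¹ * inner ℂ (W (2 * v * T)) (O T)) atTop (𝓝 z) := by
    have h0 := squeeze_zero_norm' hdiff (hε.comp scale)
    simpa using h0.add hζ
  have hw : Tendsto (fun T => 2 * v * (‖W (2 * v * T)‖ ^ 2 / (2 * (2 * v * T)))) atTop
      (𝓝 (2 * v * (‖S.cls q‖ ^ 2 * ‖S.cls q'‖ ^ 2 + ‖inner ℂ (S.cls q) (S.cls q')‖ ^ 2))) :=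
    (hN.comp scale).const_mul (2 * v)
  refine div_le_liminf hZ hw ?_
  filter_upwards [eventually_gt_atTop 0] with T hT
  refine ⟨by positivity, ?_⟩
  rw [norm_mul, norm_inv, Complex.norm_real, Real.norm_of_nonneg (by positivity : 0 ≤ 2 * T)]
  have cs := norm_inner_le_norm (𝕜 := ℂ) (W (2 * v * T)) (O T)
  have e : ‖O T‖ ^ 2 / (2 * T) * (2 * v * (‖W (2 * v * T)‖ ^ 2 / (2 * (2 * v * T))))
      = ((2 * T)⁻¹ * (‖W (2 * v * T)‖ * ‖O T‖)) ^ 2 := by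
    field_simp
  rw [e]
  gcongr

theorem diffusionBound_of_forall_gt {v₀ : ℝ} {q q' : S.V}
    (h : ∀ v, v₀ < v → S.DiffusionBound q q' v) : S.DiffusionBound q q' v₀ := by
  intro a z hz
  set N := ‖S.cls q‖ ^ 2 * ‖S.cls q'‖ ^ 2 + ‖inner ℂ (S.cls q) (S.cls q')‖ ^ 2
  have hlim : Tendsto (fun v : ℝ => ENNReal.ofReal (‖z‖ ^ 2) / ENNReal.ofReal (2 * v * N))
      (𝓝[>] v₀) (𝓝 (ENNReal.ofReal (‖z‖ ^ 2) / ENNReal.ofReal (2 * v₀ * N))) := by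
    refine ENNReal.Tendsto.const_div (ENNReal.tendsto_ofReal ?_) (Or.inr ENNReal.ofReal_ne_top)
    have : Continuous fun v : ℝ => 2 * v * N := by fun_prop
    exact (this.tendsto v₀).mono_left nhdsWithin_le_nhds
  refine le_of_tendsto hlim ?_
  filter_upwards [self_mem_nhdsWithin] with v hv
  exact h v hv a z hz

/-! ### Bilinear charges of local observables -/

theorem conn₃_eq {q q' : S.V} (hω : S.ω q = 0) (hω' : S.ω q' = 0) (b : S.V) (x y : ℝ) :
    S.conn₃ ![S.ι x (q : A), S.ι y (q' : A), (b : A)]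
      = S.ω (S.put x 0 q * S.put y 0 q' * S.put 0 0 (S.centre b)) := by
  have c1 : S.centre (S.ι x q) = S.ι x q := S.centre_eq_self (by rw [S.ω_ι, hω])
  have c2 : S.centre (S.ι y q') = S.ι y q' := S.centre_eq_self (by rw [S.ω_ι, hω'])
  simp only [conn₃, Matrix.cons_val, c1, c2, put, S.τ_zero, S.ι_zero]

theorem integrable_conn₃ {v : ℝ} (h : S.ClusteringOf v 3 S.conn₃) {q q' : S.V} (hω : S.ω q = 0)
    (hω' : S.ω q' = 0) (b : S.V) : Integrable fun y : ℝ × ℝ =>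
      S.conn₃ ![S.ι y.1 (q : A), S.ι y.2 (q' : A), (b : A)] := by
  obtain ⟨C, p, hC, hp, H⟩ := h.equal_time (by norm_num) (a := ![(q : A), q', b])
    (by intro i; fin_cases i <;> simp)
  have hφ : Integrable fun x : ℝ => (1 + |x| / 3) ^ (-(p / 3)) :=
    integrable_one_add_abs_div (by linarith) (by norm_num)
  refine Integrable.mono' ((hφ.mul_prod hφ).const_mul C) ?_ (ae_of_all _ fun y => ?_)
  · simp only [conn₃_eq hω hω']
    exact (S.continuous_corr₃ q.2 q'.2 (S.centre_mem b.2) continuous_fst continuous_const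
      continuous_snd continuous_const continuous_const continuous_const).aestronglyMeasurable
  · have e : (fun i : Fin 3 => S.ι (![y.1, y.2, 0] i) (![(q : A), q', b] i))
        = ![S.ι y.1 (q : A), S.ι y.2 (q' : A), (b : A)] := by
      ext i; fin_cases i <;> simp [S.ι_zero]
    have h1 := H ![y.1, y.2, 0] 0 2 (by decide)
    have h2 := H ![y.1, y.2, 0] 1 2 (by decide)
    rw [e] at h1 h2
    simp only [Matrix.cons_val, sub_zero] at h1 h2
    have one : ∀ w : ℝ, 1 ≤ 1 + |w| / 3 := fun w => by have := abs_nonneg w; linarith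
    have h3 := h1.trans (mul_le_mul_of_nonneg_left
      (Real.rpow_le_one_of_one_le_of_nonpos (one y.1) (by linarith : -p ≤ 0)) hC)
    have := le_mul_rpow_three hC (by linarith) (one y.1) (one y.2) le_rfl h1 h2
      (by rwa [Real.one_rpow])
    simpa using this

theorem bilinearValue_cls {v : ℝ} (h : S.ClusteringOf v 3 S.conn₃) {q q' : S.V} (hω : S.ω q = 0)
    (hω' : S.ω q' = 0) (b : S.V) : S.BilinearValue q q' (S.cls b) (S.bilinear q q' b) := by
  set g : ℝ × ℝ → ℂ := fun y => S.conn₃ ![S.ι y.1 (q : A), S.ι y.2 (q' : A), (b : A)] with hg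
  have ig : Integrable g := integrable_conn₃ h hω hω' b
  have ig' : Integrable (fun y : ℝ × ℝ => g (y.1 + y.2, y.2)) (volume.prod volume) :=
    ((measurePreserving_add_prod (volume : Measure ℝ) (volume : Measure ℝ)).integrable_comp
      ig.aestronglyMeasurable).2 ig
  have val : ∀ x, inner ℂ (S.cls (star (S.shift x q * q'))) (S.cls b) = ∫ z, g (x + z, z) := by
    intro x
    rw [← S.evolve_zero b, inner_cls_evolve]
    refine integral_congr_ae (ae_of_all _ fun z => ?_)
    simp only [cov_bilinear_evolve, hg, conn₃_eq hω hω', neg_zero]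
  have total : ∫ x, ∫ z, g (x + z, z) = S.bilinear q q' b := by
    rw [← integral_prod (fun y : ℝ × ℝ => g (y.1 + y.2, y.2)) ig', integral_prod_symm _ ig']
    have : ∀ z, ∫ x, g (x + z, z) = ∫ x, g (x, z) := fun z =>
      integral_add_right_eq_self (fun x => g (x, z)) z
    simp only [this]
    exact (integral_prod_symm g ig).symm
  unfold BilinearValue
  simp only [val]
  rw [← total]
  exact intervalIntegral_tendsto_integral ig'.integral_prod_left tendsto_neg_atTop_atBot tendsto_id

end System
end HydroProj

namespace HydroProj

/-! ### Space-like separated groups of points -/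

/-- If every point of one group is space-like to every point of the other group, then the points
also split into a left and a right group with this property. -/
theorem exists_ordered_split {n : ℕ} {v r : ℝ} (hv : 0 ≤ v) (hr : 0 ≤ r) (x t : Fin n → ℝ)
    {I : Finset (Fin n)} (hI : I.Nonempty) (hI' : Iᶜ.Nonempty)
    (h : ∀ i ∈ I, ∀ j ∈ Iᶜ, v * |t i - t j| ≤ |x i - x j| ∧ r ≤ |x i - x j|) :
    ∃ L : Finset (Fin n), L.Nonempty ∧ Lᶜ.Nonempty ∧
      ∀ i ∈ L, ∀ j ∈ Lᶜ, v * |t i - t j| ≤ x j - x i ∧ r ≤ x j - x i := by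
  classical
  have key : ∀ J : Finset (Fin n), Jᶜ.Nonempty →
      (∀ i ∈ J, ∀ j ∈ Jᶜ, v * |t i - t j| ≤ |x i - x j| ∧ r ≤ |x i - x j|) →
      ∀ m ∈ J, (∀ k, x m ≤ x k) → ∃ L : Finset (Fin n), L.Nonempty ∧ Lᶜ.Nonempty ∧
        ∀ i ∈ L, ∀ j ∈ Lᶜ, v * |t i - t j| ≤ x j - x i ∧ r ≤ x j - x i := by
    intro J hJ' hJ m hm hmin
    refine ⟨J.filter fun i => ∀ c ∈ Jᶜ, v * |t i - t c| ≤ x c - x i ∧ r ≤ x c - x i,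
      ⟨m, ?_⟩, ?_, ?_⟩
    · refine Finset.mem_filter.2 ⟨hm, fun c hc => ?_⟩
      have := hJ m hm c hc
      rwa [abs_sub_comm (x m), abs_of_nonneg (sub_nonneg.2 (hmin c))] at this
    · obtain ⟨c, hc⟩ := hJ'
      exact ⟨c, Finset.mem_compl.2 fun hc' =>
        Finset.mem_compl.1 hc (Finset.mem_filter.1 hc').1⟩
    · intro i hi j hj
      obtain ⟨-, hi⟩ := Finset.mem_filter.1 hi
      by_cases hjJ : j ∈ J
      · have hj' : ¬ ∀ c ∈ Jᶜ, v * |t j - t c| ≤ x c - x j ∧ r ≤ x c - x j := fun hj' =>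
          Finset.mem_compl.1 hj (Finset.mem_filter.2 ⟨hjJ, hj'⟩)
        push Not at hj'
        obtain ⟨c, hc, hjc⟩ := hj'
        have h1 := hJ j hjJ c hc
        have h2 := hi c hc
        have h3 : |x j - x c| = x j - x c := by
          rcases le_total (x j) (x c) with hle | hle
          · rw [abs_sub_comm (x j), abs_of_nonneg (sub_nonneg.2 hle)] at h1
            exact absurd h1.2 (not_le.2 (hjc h1.1))
          · exact abs_of_nonneg (sub_nonneg.2 hle)
        rw [h3] at h1
        have h4 : v * |t i - t j| ≤ v * (|t i - t c| + |t j - t c|) := by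
          gcongr
          rw [abs_sub_comm (t j)]
          exact abs_sub_le _ _ _
        constructor <;> linarith
      · exact hi j (Finset.mem_compl.2 hjJ)
  obtain ⟨i₀, hi₀⟩ := hI
  obtain ⟨m, -, hm⟩ := Finset.exists_min_image Finset.univ x ⟨i₀, Finset.mem_univ _⟩
  by_cases hmI : m ∈ I
  · exact key I hI' h m hmI fun k => hm k (Finset.mem_univ k)
  · refine key Iᶜ (by rw [compl_compl]; exact ⟨_, hi₀⟩) (fun i hi j hj => ?_) m
      (Finset.mem_compl.2 hmI) fun k => hm k (Finset.mem_univ k)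
    rw [compl_compl] at hj
    rw [abs_sub_comm (t i), abs_sub_comm (x i)]
    exact h j hj i hi

/-- There is a time at which the light cones, of a smaller velocity `u`, of the left and of the
right group of points are separated. -/
theorem exists_separating_time {n : ℕ} {u v r : ℝ} (hu : 0 < u) (huv : u < v) (x t : Fin n → ℝ)
    {L : Finset (Fin n)} (hL : L.Nonempty) (hL' : Lᶜ.Nonempty)
    (h : ∀ i ∈ L, ∀ j ∈ Lᶜ, v * |t i - t j| ≤ x j - x i ∧ r ≤ x j - x i) :
    ∃ t₀, ∀ i ∈ L, ∀ j ∈ Lᶜ,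
      (1 - u / v) * r + u * (|t i - t₀| + |t j - t₀|) ≤ x j - x i := by
  have hv : 0 < v := hu.trans huv
  set δ := (1 - u / v) * r
  have hc : 0 ≤ 1 - u / v := by
    rw [sub_nonneg, div_le_one hv]
    exact huv.le
  have base : ∀ i ∈ L, ∀ j ∈ Lᶜ, u * |t i - t j| ≤ x j - x i - δ := by
    intro i hi j hj
    obtain ⟨h1, h2⟩ := h i hi j hj
    have h3 : u * |t i - t j| ≤ u / v * (x j - x i) := by
      rw [div_mul_eq_mul_div, le_div_iff₀ hv]
      nlinarith
    have h4 : δ ≤ (1 - u / v) * (x j - x i) := mul_le_mul_of_nonneg_left h2 hc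
    linarith
  set lo : Fin n × Fin n → ℝ := fun p => (t p.1 + t p.2 - (x p.2 - x p.1 - δ) / u) / 2 with hlo
  have hne : (L ×ˢ Lᶜ).Nonempty := hL.product hL'
  refine ⟨(L ×ˢ Lᶜ).sup' hne lo, fun i hi j hj => ?_⟩
  obtain ⟨⟨k, l⟩, hkl, heq⟩ := Finset.exists_mem_eq_sup' hne lo
  have hge : lo (i, j) ≤ (L ×ˢ Lᶜ).sup' hne lo :=
    Finset.le_sup' lo (Finset.mem_product.2 ⟨hi, hj⟩)
  obtain ⟨hk, hl⟩ := Finset.mem_product.1 hkl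
  set t₀ := (L ×ˢ Lᶜ).sup' hne lo
  have e1 : 2 * (u * t₀) = u * t k + u * t l - (x l - x k - δ) := by
    rw [heq]
    simp only [hlo]
    field_simp
  have e2 : u * t i + u * t j - (x j - x i - δ) ≤ 2 * (u * t₀) := by
    have : u * t i + u * t j - (x j - x i - δ) = 2 * (u * lo (i, j)) := by
      simp only [hlo]
      field_simp
    rw [this]
    gcongr
  have bij := base i hi j hj
  have bil := base i hi l hl
  have bkj := base k hk j hj
  have m : ∀ a b : ℝ, u * |a - b| = |u * a - u * b| := fun a b => by
    rw [← mul_sub, abs_mul, abs_of_pos hu]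
  rw [mul_add, m, m]
  rw [m] at bij bil bkj
  obtain ⟨b1, b2⟩ := abs_le.1 bij
  obtain ⟨b3, b4⟩ := abs_le.1 bil
  obtain ⟨b5, b6⟩ := abs_le.1 bkj
  rcases abs_cases (u * t i - u * t₀) with ⟨ei, -⟩ | ⟨ei, -⟩ <;>
    rcases abs_cases (u * t j - u * t₀) with ⟨ej, -⟩ | ⟨ej, -⟩ <;> rw [ei, ej] <;> linarith

theorem exists_exp_le_rpow {c : ℝ} (hc : 0 < c) :
    ∃ E : ℝ, 0 ≤ E ∧ ∀ r, 0 ≤ r → Real.exp (-(c * r)) ≤ E * (1 + r) ^ (-4 : ℝ) := by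
  refine ⟨24 * Real.exp c / c ^ 4, by positivity, fun r hr => ?_⟩
  have h := Real.pow_div_factorial_le_exp (x := c * (1 + r)) (by positivity) 4
  have hf : ((Nat.factorial 4 : ℕ) : ℝ) = 24 := by norm_num [Nat.factorial]
  rw [hf, mul_add, mul_one, Real.exp_add] at h
  rw [Real.exp_neg, Real.rpow_neg (by positivity),
    show (4 : ℝ) = ((4 : ℕ) : ℝ) by norm_num, Real.rpow_natCast, ← div_eq_mul_inv,
    le_div_iff₀ (by positivity), inv_mul_eq_div, div_le_div_iff₀ (Real.exp_pos _) (by positivity)]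
  have e : (c + c * r) ^ 4 = (1 + r) ^ 4 * c ^ 4 := by ring
  rw [e] at h
  linarith

namespace System

variable {A : Type*} [Ring A] [StarRing A] [Algebra ℂ A] [StarModule ℂ A] {S : System A}

namespace LocalNet

variable (M : S.LocalNet)

theorem mul_le {a b : A} {α β : ℝ} (ha : M.N a ≤ α) (hb : M.N b ≤ β) : M.N (a * b) ≤ α * β :=
  (M.N_mul a b).trans (mul_le_mul ha hb (apply_nonneg _ _) ((apply_nonneg _ _).trans ha))

theorem mul_sub_le {a a' b b' : A} {α β η θ : ℝ} (ha : M.N a' ≤ α) (hb : M.N b ≤ β)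
    (haa : M.N (a - a') ≤ η) (hbb : M.N (b - b') ≤ θ) :
    M.N (a * b - a' * b') ≤ η * β + α * θ := by
  have e : a * b - a' * b' = (a - a') * b + a' * (b - b') := by rw [sub_mul, mul_sub]; abel
  rw [e]
  exact (map_add_le_add M.N _ _).trans (add_le_add (M.mul_le haa hb) (M.mul_le ha hbb))

theorem ω_le_of_le {a : A} {α : ℝ} (ha : M.N a ≤ α) : ‖S.ω a‖ ≤ α := (M.ω_le a).trans ha

theorem ω_sub_le {a b : A} {α : ℝ} (h : M.N (a - b) ≤ α) : ‖S.ω a - S.ω b‖ ≤ α := by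
  rw [← map_sub]
  exact M.ω_le_of_le h

theorem N_centre_le (a : A) : M.N (S.centre a) ≤ M.N a * (1 + M.N 1) := by
  rw [centre, Algebra.algebraMap_eq_smul_one]
  refine (map_sub_le_add M.N _ _).trans ?_
  rw [map_smul_eq_mul, mul_add, mul_one]
  gcongr
  exact M.ω_le a

/-- Two commuting algebras of observables that are nearly independent in the state. -/
structure Indep (B B' : StarSubalgebra ℂ A) (ε : ℝ) : Prop where
  nonneg : 0 ≤ ε
  comm : ∀ a ∈ B, ∀ b ∈ B', a * b = b * a
  fac : ∀ a ∈ B, ∀ b ∈ B', ‖S.ω (a * b) - S.ω a * S.ω b‖ ≤ ε * (M.N a * M.N b)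

variable {M} {B B' : StarSubalgebra ℂ A} {ε η K : ℝ} {a b c d : A}

theorem Indep.symm (h : M.Indep B B' ε) : M.Indep B' B ε where
  nonneg := h.nonneg
  comm a ha b hb := (h.comm b hb a ha).symm
  fac a ha b hb := by
    have := h.fac b hb a ha
    rwa [h.comm b hb a ha, mul_comm (S.ω b), mul_comm (M.N b)] at this

theorem Indep.fac_le (h : M.Indep B B' ε) (ha : a ∈ B) (hb : b ∈ B') {α β : ℝ} (hα : M.N a ≤ α)
    (hβ : M.N b ≤ β) : ‖S.ω (a * b) - S.ω a * S.ω b‖ ≤ ε * (α * β) :=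
  (h.fac a ha b hb).trans (mul_le_mul_of_nonneg_left (mul_le_mul hα hβ (apply_nonneg _ _)
    ((apply_nonneg _ _).trans hα)) h.nonneg)

theorem Indep.ω_mul_le (h : M.Indep B B' ε) (ha : a ∈ B) (hb : b ∈ B') (h0 : S.ω a = 0)
    {α β : ℝ} (hα : M.N a ≤ α) (hβ : M.N b ≤ β) : ‖S.ω (a * b)‖ ≤ ε * (α * β) := by
  simpa [h0] using h.fac_le ha hb hα hβ

theorem Indep.three_le₀ (h : M.Indep B B' ε) (ha : a ∈ B) (hb : b ∈ B') (hc : c ∈ B')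
    (a0 : S.ω a = 0) (hKa : M.N a ≤ K) (hKb : M.N b ≤ K) (hKc : M.N c ≤ K) :
    ‖S.ω (a * b * c)‖ ≤ ε * (K * (K * K)) := by
  rw [mul_assoc]
  exact h.ω_mul_le ha (mul_mem hb hc) a0 hKa (M.mul_le hKb hKc)

theorem Indep.three_le₁ (h : M.Indep B B' ε) (ha : a ∈ B') (hb : b ∈ B) (hc : c ∈ B')
    (b0 : S.ω b = 0) (hKa : M.N a ≤ K) (hKb : M.N b ≤ K) (hKc : M.N c ≤ K) :
    ‖S.ω (a * b * c)‖ ≤ ε * (K * (K * K)) := by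
  rw [← h.comm b hb a ha]
  exact h.three_le₀ hb ha hc b0 hKb hKa hKc

theorem Indep.three_le₂ (h : M.Indep B B' ε) (ha : a ∈ B') (hb : b ∈ B') (hc : c ∈ B)
    (c0 : S.ω c = 0) (hKa : M.N a ≤ K) (hKb : M.N b ≤ K) (hKc : M.N c ≤ K) :
    ‖S.ω (a * b * c)‖ ≤ ε * (K * (K * K)) := by
  rw [← h.comm c hc _ (mul_mem ha hb), ← mul_assoc]
  exact h.three_le₀ hc ha hb c0 hKc hKa hKb

/-- The connected four-point function of centred observables. -/
def cumulant (S : System A) (a b c d : A) : ℂ :=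
  S.ω (a * b * c * d) - S.ω (a * b) * S.ω (c * d) - S.ω (a * c) * S.ω (b * d)
    - S.ω (a * d) * S.ω (b * c)

theorem norm_sub_three_le {w x y z : ℂ} {α β : ℝ} (hw : ‖w‖ ≤ α) (hx : ‖x‖ ≤ β) (hy : ‖y‖ ≤ β)
    (hz : ‖z‖ ≤ β) : ‖w - x - y - z‖ ≤ α + 3 * β := by
  have h1 := norm_sub_le (w - x - y) z
  have h2 := norm_sub_le (w - x) y
  have h3 := norm_sub_le w x
  linarith

theorem norm_mul_le_left {x y : ℂ} (hx : ‖x‖ ≤ ε * (K * K)) (hy : ‖y‖ ≤ K * K) :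
    ‖x * y‖ ≤ ε * K ^ 4 := by
  rw [norm_mul]
  refine (mul_le_mul hx hy (norm_nonneg _) ((norm_nonneg _).trans hx)).trans (le_of_eq (by ring))

theorem norm_mul_le_right {x y : ℂ} (hx : ‖x‖ ≤ K * K) (hy : ‖y‖ ≤ ε * (K * K)) :
    ‖x * y‖ ≤ ε * K ^ 4 := by
  rw [mul_comm]
  exact norm_mul_le_left hy hx

/-- One observable in one algebra and three in the other. -/
theorem Indep.cumulant_le_of_single (h : M.Indep B B' ε)
    (hm : (a ∈ B ∧ b ∈ B' ∧ c ∈ B' ∧ d ∈ B') ∨ (a ∈ B' ∧ b ∈ B ∧ c ∈ B' ∧ d ∈ B') ∨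
      (a ∈ B' ∧ b ∈ B' ∧ c ∈ B ∧ d ∈ B') ∨ (a ∈ B' ∧ b ∈ B' ∧ c ∈ B' ∧ d ∈ B))
    (a0 : S.ω a = 0) (b0 : S.ω b = 0) (c0 : S.ω c = 0) (d0 : S.ω d = 0)
    (hKa : M.N a ≤ K) (hKb : M.N b ≤ K) (hKc : M.N c ≤ K) (hKd : M.N d ≤ K) :
    ‖cumulant S a b c d‖ ≤ 4 * (ε * K ^ 4) := by
  have e4 : 4 * (ε * K ^ 4) = ε * (K * (K * K * K)) + 3 * (ε * K ^ 4) := by ring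
  have p2 : ∀ {x y : A}, M.N x ≤ K → M.N y ≤ K → ‖S.ω (x * y)‖ ≤ K * K := fun hx hy =>
    M.ω_le_of_le (M.mul_le hx hy)
  have p3 : ∀ {x y z : A}, M.N x ≤ K → M.N y ≤ K → M.N z ≤ K → M.N (x * y * z) ≤ K * K * K :=
    fun hx hy hz => M.mul_le (M.mul_le hx hy) hz
  rw [e4]
  rcases hm with ⟨ha, hb, hc, hd⟩ | ⟨ha, hb, hc, hd⟩ | ⟨ha, hb, hc, hd⟩ | ⟨ha, hb, hc, hd⟩
  · refine norm_sub_three_le ?_ (norm_mul_le_left (h.ω_mul_le ha hb a0 hKa hKb) (p2 hKc hKd))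
      (norm_mul_le_left (h.ω_mul_le ha hc a0 hKa hKc) (p2 hKb hKd))
      (norm_mul_le_left (h.ω_mul_le ha hd a0 hKa hKd) (p2 hKb hKc))
    rw [mul_assoc, mul_assoc, ← mul_assoc b]
    exact h.ω_mul_le ha (mul_mem (mul_mem hb hc) hd) a0 hKa (p3 hKb hKc hKd)
  · refine norm_sub_three_le ?_
      (norm_mul_le_left (h.symm.ω_mul_le ha hb a0 hKa hKb) (p2 hKc hKd))
      (norm_mul_le_right (p2 hKa hKc) (h.ω_mul_le hb hd b0 hKb hKd))
      (norm_mul_le_right (p2 hKa hKd) (h.ω_mul_le hb hc b0 hKb hKc))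
    rw [← h.comm b hb a ha, mul_assoc, mul_assoc, ← mul_assoc a]
    exact h.ω_mul_le hb (mul_mem (mul_mem ha hc) hd) b0 hKb (p3 hKa hKc hKd)
  · refine norm_sub_three_le ?_
      (norm_mul_le_right (p2 hKa hKb) (h.ω_mul_le hc hd c0 hKc hKd))
      (norm_mul_le_left (h.symm.ω_mul_le ha hc a0 hKa hKc) (p2 hKb hKd))
      (norm_mul_le_right (p2 hKa hKd) (h.symm.ω_mul_le hb hc b0 hKb hKc))
    rw [← h.comm c hc _ (mul_mem ha hb), mul_assoc]
    exact h.ω_mul_le hc (mul_mem (mul_mem ha hb) hd) c0 hKc (p3 hKa hKb hKd)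
  · refine norm_sub_three_le ?_
      (norm_mul_le_right (p2 hKa hKb) (h.symm.ω_mul_le hc hd c0 hKc hKd))
      (norm_mul_le_right (p2 hKa hKc) (h.symm.ω_mul_le hb hd b0 hKb hKd))
      (norm_mul_le_left (h.symm.ω_mul_le ha hd a0 hKa hKd) (p2 hKb hKc))
    rw [← h.comm d hd _ (mul_mem (mul_mem ha hb) hc)]
    exact h.ω_mul_le hd (mul_mem (mul_mem ha hb) hc) d0 hKd (p3 hKa hKb hKc)

/-- Two observables in each of the algebras. -/
theorem Indep.cumulant_le_of_pair (h : M.Indep B B' ε)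
    (hm : (a ∈ B ∧ b ∈ B ∧ c ∈ B' ∧ d ∈ B') ∨ (a ∈ B ∧ b ∈ B' ∧ c ∈ B ∧ d ∈ B') ∨
      (a ∈ B ∧ b ∈ B' ∧ c ∈ B' ∧ d ∈ B))
    (a0 : S.ω a = 0)
    (hKa : M.N a ≤ K) (hKb : M.N b ≤ K) (hKc : M.N c ≤ K) (hKd : M.N d ≤ K) :
    ‖cumulant S a b c d‖ ≤ 4 * (ε * K ^ 4) := by
  have hK : 0 ≤ K := (apply_nonneg _ _).trans hKa
  have hεK : 0 ≤ ε * K ^ 4 := mul_nonneg h.nonneg (by positivity)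
  have e3 : ε * (K * K * (K * K)) + 3 * (ε * K ^ 4) = 4 * (ε * K ^ 4) := by ring
  have p2 : ∀ {x y : A}, M.N x ≤ K → M.N y ≤ K → ‖S.ω (x * y)‖ ≤ K * K := fun hx hy =>
    M.ω_le_of_le (M.mul_le hx hy)
  have z : ‖(0 : ℂ)‖ ≤ ε * K ^ 4 := by simpa using hεK
  rcases hm with ⟨ha, hb, hc, hd⟩ | ⟨ha, hb, hc, hd⟩ | ⟨ha, hb, hc, hd⟩
  · have e : cumulant S a b c d = (S.ω (a * b * (c * d)) - S.ω (a * b) * S.ω (c * d)) - 0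
        - S.ω (a * c) * S.ω (b * d) - S.ω (a * d) * S.ω (b * c) := by
      rw [cumulant, ← mul_assoc, sub_zero]
    rw [e, ← e3]
    exact norm_sub_three_le (h.fac_le (mul_mem ha hb) (mul_mem hc hd) (M.mul_le hKa hKb)
      (M.mul_le hKc hKd)) z
      (norm_mul_le_left (h.ω_mul_le ha hc a0 hKa hKc) (p2 hKb hKd))
      (norm_mul_le_left (h.ω_mul_le ha hd a0 hKa hKd) (p2 hKb hKc))
  · have e : cumulant S a b c d = (S.ω (a * c * (b * d)) - S.ω (a * c) * S.ω (b * d))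
        - S.ω (a * b) * S.ω (c * d) - 0 - S.ω (a * d) * S.ω (b * c) := by
      rw [cumulant, mul_assoc a b c, ← h.comm c hc b hb, ← mul_assoc a c b, mul_assoc (a * c)]
      ring
    rw [e, ← e3]
    exact norm_sub_three_le (h.fac_le (mul_mem ha hc) (mul_mem hb hd) (M.mul_le hKa hKc)
      (M.mul_le hKb hKd))
      (norm_mul_le_left (h.ω_mul_le ha hb a0 hKa hKb) (p2 hKc hKd)) z
      (norm_mul_le_left (h.ω_mul_le ha hd a0 hKa hKd) (p2 hKb hKc))
  · have e : cumulant S a b c d = (S.ω (a * d * (b * c)) - S.ω (a * d) * S.ω (b * c))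
        - S.ω (a * b) * S.ω (c * d) - S.ω (a * c) * S.ω (b * d) - 0 := by
      rw [cumulant, mul_assoc a b c, mul_assoc a, ← h.comm d hd _ (mul_mem hb hc), ← mul_assoc a d]
      ring
    rw [e, ← e3]
    exact norm_sub_three_le (h.fac_le (mul_mem ha hd) (mul_mem hb hc) (M.mul_le hKa hKd)
      (M.mul_le hKb hKc))
      (norm_mul_le_left (h.ω_mul_le ha hb a0 hKa hKb) (p2 hKc hKd))
      (norm_mul_le_left (h.ω_mul_le ha hc a0 hKa hKc) (p2 hKb hKd)) z

variable (M) in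
/-- The functional `F` of `n` observables is uniformly small on observables that are close to two
groups of observables from nearly independent algebras. -/
def Factorizing (n : ℕ) (F : (Fin n → A) → ℂ) : Prop :=
  ∀ K : ℝ, 0 ≤ K → ∃ D : ℝ, 0 ≤ D ∧
    (∀ a : Fin n → A, (∀ i, M.N (S.centre (a i)) ≤ K) → ‖F a‖ ≤ D) ∧
    ∀ (ε η : ℝ) (B B' : StarSubalgebra ℂ A), 0 ≤ η → M.Indep B B' ε → ∀ (a b : Fin n → A)
      (L : Finset (Fin n)), L.Nonempty → Lᶜ.Nonempty → (∀ i, M.N (S.centre (a i)) ≤ K) →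
      (∀ i, M.N (S.centre (b i)) ≤ K) → (∀ i, M.N (S.centre (a i) - S.centre (b i)) ≤ η) →
      (∀ i ∈ L, b i ∈ B) → (∀ i ∈ Lᶜ, b i ∈ B') → ‖F a‖ ≤ D * (ε + η)

theorem centre_mem_of_mem {B : StarSubalgebra ℂ A} {a : A} (ha : a ∈ B) : S.centre a ∈ B :=
  sub_mem ha (algebraMap_mem B _)

theorem norm_le_add {x y : ℂ} {α β : ℝ} (h : ‖x - y‖ ≤ β) (hy : ‖y‖ ≤ α) : ‖x‖ ≤ α + β := by
  have := norm_add_le (x - y) y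
  rw [sub_add_cancel] at this
  linarith

theorem factorizing_conn₂ : M.Factorizing 2 S.conn₂ := by
  intro K hK
  refine ⟨K * K + 2 * K, by positivity, fun a ha => ?_, ?_⟩
  · have := M.ω_le_of_le (M.mul_le (ha 0) (ha 1))
    exact this.trans (by linarith)
  intro ε η B B' hη h a b L hL hL' ha hb hab hB hB'
  have hdiff : ‖S.conn₂ a - S.conn₂ b‖ ≤ η * K + K * η :=
    M.ω_sub_le (M.mul_sub_le (hb 0) (ha 1) (hab 0) (hab 1))
  have key : ‖S.conn₂ b‖ ≤ ε * (K * K) := by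
    by_cases h0 : (0 : Fin 2) ∈ L <;> by_cases h1 : (1 : Fin 2) ∈ L
    · obtain ⟨k, hk⟩ := hL'
      fin_cases k <;> simp_all
    · exact h.ω_mul_le (centre_mem_of_mem (hB 0 h0))
        (centre_mem_of_mem (hB' 1 (Finset.mem_compl.2 h1))) (S.ω_centre _) (hb 0) (hb 1)
    · exact h.symm.ω_mul_le (centre_mem_of_mem (hB' 0 (Finset.mem_compl.2 h0)))
        (centre_mem_of_mem (hB 1 h1)) (S.ω_centre _) (hb 0) (hb 1)
    · obtain ⟨k, hk⟩ := hL
      fin_cases k <;> simp_all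
  refine (norm_le_add hdiff key).trans ?_
  have h1 := mul_nonneg h.nonneg hK
  have h2 := mul_nonneg (mul_nonneg hη hK) hK
  nlinarith

theorem factorizing_conn₃ : M.Factorizing 3 S.conn₃ := by
  intro K hK
  refine ⟨K * (K * K) + 3 * (K * K), by positivity, fun a ha => ?_, ?_⟩
  · have := M.ω_le_of_le (M.mul_le (M.mul_le (ha 0) (ha 1)) (ha 2))
    refine this.trans ?_
    nlinarith [mul_nonneg hK hK]
  intro ε η B B' hη h a b L hL hL' ha hb hab hB hB'
  have hdiff : ‖S.conn₃ a - S.conn₃ b‖ ≤ (η * K + K * η) * K + K * K * η :=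
    M.ω_sub_le (M.mul_sub_le (M.mul_le (hb 0) (hb 1)) (ha 2)
      (M.mul_sub_le (hb 0) (ha 1) (hab 0) (hab 1)) (hab 2))
  have cB : ∀ i, i ∈ L → S.centre (b i) ∈ B := fun i hi => centre_mem_of_mem (hB i hi)
  have cB' : ∀ i, i ∉ L → S.centre (b i) ∈ B' := fun i hi =>
    centre_mem_of_mem (hB' i (Finset.mem_compl.2 hi))
  have key : ‖S.conn₃ b‖ ≤ ε * (K * (K * K)) := by
    by_cases h0 : (0 : Fin 3) ∈ L <;> by_cases h1 : (1 : Fin 3) ∈ L <;>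
      by_cases h2 : (2 : Fin 3) ∈ L
    · obtain ⟨k, hk⟩ := hL'
      fin_cases k <;> simp_all
    · exact h.symm.three_le₂ (cB 0 h0) (cB 1 h1) (cB' 2 h2) (S.ω_centre _) (hb 0) (hb 1) (hb 2)
    · exact h.symm.three_le₁ (cB 0 h0) (cB' 1 h1) (cB 2 h2) (S.ω_centre _) (hb 0) (hb 1) (hb 2)
    · exact h.three_le₀ (cB 0 h0) (cB' 1 h1) (cB' 2 h2) (S.ω_centre _) (hb 0) (hb 1) (hb 2)
    · exact h.symm.three_le₀ (cB' 0 h0) (cB 1 h1) (cB 2 h2) (S.ω_centre _) (hb 0) (hb 1) (hb 2)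
    · exact h.three_le₁ (cB' 0 h0) (cB 1 h1) (cB' 2 h2) (S.ω_centre _) (hb 0) (hb 1) (hb 2)
    · exact h.three_le₂ (cB' 0 h0) (cB' 1 h1) (cB 2 h2) (S.ω_centre _) (hb 0) (hb 1) (hb 2)
    · obtain ⟨k, hk⟩ := hL
      fin_cases k <;> simp_all
  refine (norm_le_add hdiff key).trans ?_
  have h1 := mul_nonneg h.nonneg (mul_nonneg hK hK)
  have h2 := mul_nonneg (mul_nonneg hη hK) (mul_nonneg hK hK)
  nlinarith

theorem norm_mul_sub_mul_le {x y x' y' : ℂ} {α β : ℝ} (hx : ‖x'‖ ≤ α) (hy : ‖y‖ ≤ α)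
    (hxx : ‖x - x'‖ ≤ β) (hyy : ‖y - y'‖ ≤ β) : ‖x * y - x' * y'‖ ≤ 2 * (α * β) := by
  have e : x * y - x' * y' = (x - x') * y + x' * (y - y') := by ring
  have hα := (norm_nonneg _).trans hx
  have hβ := (norm_nonneg _).trans hxx
  rw [e]
  refine (norm_add_le _ _).trans ?_
  rw [norm_mul, norm_mul]
  have h1 := mul_le_mul hxx hy (norm_nonneg _) hβ
  have h2 := mul_le_mul hx hyy (norm_nonneg _) hα
  linarith

theorem factorizing_conn₄ : M.Factorizing 4 S.conn₄ := by
  intro K hK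
  refine ⟨4 * K ^ 4 + 16 * K ^ 3, by positivity, fun a ha => ?_, ?_⟩
  · have p2 : ∀ i j, ‖S.ω (S.centre (a i) * S.centre (a j))‖ ≤ K * K := fun i j =>
      M.ω_le_of_le (M.mul_le (ha i) (ha j))
    have p22 : ∀ i j k l, ‖S.ω (S.centre (a i) * S.centre (a j))
        * S.ω (S.centre (a k) * S.centre (a l))‖ ≤ 1 * K ^ 4 := fun i j k l =>
      norm_mul_le_left (by simpa using p2 i j) (p2 k l)
    have := norm_sub_three_le (M.ω_le_of_le (M.mul_le (M.mul_le (M.mul_le (ha 0) (ha 1)) (ha 2))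
      (ha 3))) (p22 0 1 2 3) (p22 0 2 1 3) (p22 0 3 1 2)
    refine this.trans ?_
    have : 0 ≤ K ^ 3 := by positivity
    linarith
  intro ε η B B' hη h a b L hL hL' ha hb hab hB hB'
  have hdiff : ‖S.conn₄ a - S.conn₄ b‖ ≤ 16 * K ^ 3 * η := by
    have d2 : ∀ i j, ‖S.ω (S.centre (a i) * S.centre (a j))
        - S.ω (S.centre (b i) * S.centre (b j))‖ ≤ η * K + K * η := fun i j =>
      M.ω_sub_le (M.mul_sub_le (hb i) (ha j) (hab i) (hab j))
    have d22 : ∀ i j k l, ‖S.ω (S.centre (a i) * S.centre (a j))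
        * S.ω (S.centre (a k) * S.centre (a l)) - S.ω (S.centre (b i) * S.centre (b j))
        * S.ω (S.centre (b k) * S.centre (b l))‖ ≤ 2 * (K * K * (η * K + K * η)) :=
      fun i j k l => norm_mul_sub_mul_le (M.ω_le_of_le (M.mul_le (hb i) (hb j)))
        (M.ω_le_of_le (M.mul_le (ha k) (ha l))) (d2 i j) (d2 k l)
    have d4 := M.ω_sub_le (M.mul_sub_le (M.mul_le (M.mul_le (hb 0) (hb 1)) (hb 2)) (ha 3)
      (M.mul_sub_le (M.mul_le (hb 0) (hb 1)) (ha 2)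
        (M.mul_sub_le (hb 0) (ha 1) (hab 0) (hab 1)) (hab 2)) (hab 3))
    have := norm_sub_three_le d4 (d22 0 1 2 3) (d22 0 2 1 3) (d22 0 3 1 2)
    refine le_trans (le_of_eq (congrArg _ ?_)) (this.trans (le_of_eq (by ring)))
    simp only [conn₄]
    ring
  have cB : ∀ i, i ∈ L → S.centre (b i) ∈ B := fun i hi => centre_mem_of_mem (hB i hi)
  have cB' : ∀ i, i ∉ L → S.centre (b i) ∈ B' := fun i hi =>
    centre_mem_of_mem (hB' i (Finset.mem_compl.2 hi))
  have single : ∀ {B B' : StarSubalgebra ℂ A}, M.Indep B B' ε → _ → ‖S.conn₄ b‖ ≤ 4 * (ε * K ^ 4) :=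
    fun h hm => h.cumulant_le_of_single hm (S.ω_centre (b 0)) (S.ω_centre (b 1)) (S.ω_centre (b 2))
      (S.ω_centre (b 3)) (hb 0) (hb 1) (hb 2) (hb 3)
  have pair : ∀ {B B' : StarSubalgebra ℂ A}, M.Indep B B' ε → _ → ‖S.conn₄ b‖ ≤ 4 * (ε * K ^ 4) :=
    fun h hm => h.cumulant_le_of_pair hm (S.ω_centre (b 0)) (hb 0) (hb 1) (hb 2)
      (hb 3)
  have key : ‖S.conn₄ b‖ ≤ 4 * (ε * K ^ 4) := by
    by_cases h0 : (0 : Fin 4) ∈ L <;> by_cases h1 : (1 : Fin 4) ∈ L <;>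
      by_cases h2 : (2 : Fin 4) ∈ L <;> by_cases h3 : (3 : Fin 4) ∈ L
    · obtain ⟨k, hk⟩ := hL'
      fin_cases k <;> simp_all
    · exact single h.symm (Or.inr (Or.inr (Or.inr ⟨cB 0 h0, cB 1 h1, cB 2 h2, cB' 3 h3⟩)))
    · exact single h.symm (Or.inr (Or.inr (Or.inl ⟨cB 0 h0, cB 1 h1, cB' 2 h2, cB 3 h3⟩)))
    · exact pair h (Or.inl ⟨cB 0 h0, cB 1 h1, cB' 2 h2, cB' 3 h3⟩)
    · exact single h.symm (Or.inr (Or.inl ⟨cB 0 h0, cB' 1 h1, cB 2 h2, cB 3 h3⟩))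
    · exact pair h (Or.inr (Or.inl ⟨cB 0 h0, cB' 1 h1, cB 2 h2, cB' 3 h3⟩))
    · exact pair h (Or.inr (Or.inr ⟨cB 0 h0, cB' 1 h1, cB' 2 h2, cB 3 h3⟩))
    · exact single h (Or.inl ⟨cB 0 h0, cB' 1 h1, cB' 2 h2, cB' 3 h3⟩)
    · exact single h.symm (Or.inl ⟨cB' 0 h0, cB 1 h1, cB 2 h2, cB 3 h3⟩)
    · exact pair h.symm (Or.inr (Or.inr ⟨cB' 0 h0, cB 1 h1, cB 2 h2, cB' 3 h3⟩))
    · exact pair h.symm (Or.inr (Or.inl ⟨cB' 0 h0, cB 1 h1, cB' 2 h2, cB 3 h3⟩))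
    · exact single h (Or.inr (Or.inl ⟨cB' 0 h0, cB 1 h1, cB' 2 h2, cB' 3 h3⟩))
    · exact pair h.symm (Or.inl ⟨cB' 0 h0, cB' 1 h1, cB 2 h2, cB 3 h3⟩)
    · exact single h (Or.inr (Or.inr (Or.inl ⟨cB' 0 h0, cB' 1 h1, cB 2 h2, cB' 3 h3⟩)))
    · exact single h (Or.inr (Or.inr (Or.inr ⟨cB' 0 h0, cB' 1 h1, cB' 2 h2, cB 3 h3⟩)))
    · obtain ⟨k, hk⟩ := hL
      fin_cases k <;> simp_all
  refine (norm_le_add hdiff key).trans ?_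
  have h1 : 0 ≤ ε * K ^ 3 := mul_nonneg h.nonneg (by positivity)
  have h2 : 0 ≤ η * K ^ 4 := by positivity
  nlinarith

end LocalNet
end System
end HydroProj

namespace HydroProj
namespace System

variable {A : Type*} [Ring A] [StarRing A] [Algebra ℂ A] [StarModule ℂ A] {S : System A}

namespace LocalNet

variable {M : S.LocalNet}

/-- A Lieb-Robinson bound and exponential clustering in space imply space-time clustering. -/
theorem Factorizing.clusteringOf {n : ℕ} {F : (Fin n → A) → ℂ} (hF : M.Factorizing n F)
    (hτ : ∀ s (a : Fin n → A), F (fun i => S.τ s (a i)) = F a) {vLR v : ℝ} (hLR0 : 0 ≤ vLR)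
    (hv : vLR < v) (hLR : M.LiebRobinson vLR) (hexp : M.ExpClustering) :
    S.ClusteringOf v n F := by
  intro a ha
  choose C₀ μ₀ hμ₀ H₀ using fun i => hLR (a i) (ha i)
  obtain ⟨μ, hμ, hμ0⟩ : ∃ μ : ℝ, (∀ i, μ ≤ μ₀ i) ∧ 0 < μ :=
    ((eventually_all.2 fun i => (eventually_le_nhds (hμ₀ i)).filter_mono nhdsWithin_le_nhds).and
      (self_mem_nhdsWithin : Set.Ioi (0 : ℝ) ∈ 𝓝[>] 0)).exists
  obtain ⟨C₁, κ, hκ, H₁⟩ := hexp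
  set C := ∑ i, |C₀ i| with hC
  have hC0 : 0 ≤ C := Finset.sum_nonneg fun i _ => abs_nonneg _
  have hCi : ∀ i, C₀ i ≤ C := fun i => (le_abs_self _).trans
    (Finset.single_le_sum (f := fun i => |C₀ i|) (fun _ _ => abs_nonneg _) (Finset.mem_univ i))
  set P := 1 + M.N 1 with hP
  have hP0 : 0 ≤ P := add_nonneg zero_le_one (apply_nonneg _ _)
  set Q := ∑ i, M.N (a i) with hQ
  have hQ0 : 0 ≤ Q := Finset.sum_nonneg fun i _ => apply_nonneg _ _
  have hQi : ∀ i, M.N (a i) ≤ Q := fun i =>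
    Finset.single_le_sum (f := fun i => M.N (a i)) (fun _ _ => apply_nonneg _ _) (Finset.mem_univ i)
  obtain ⟨D, hD, hbd, hfac⟩ := hF ((Q + C) * P) (by positivity)
  set u := (vLR + v) / 2 with hu
  have hu0 : 0 < u := by rw [hu]; linarith
  have huv : u < v := by rw [hu]; linarith
  have hLRu : vLR ≤ u := by rw [hu]; linarith
  have hv0 : 0 < v := hu0.trans huv
  have hc0 : 0 < 1 - u / v := by rw [sub_pos, div_lt_one hv0]; exact huv
  obtain ⟨E₁, hE₁, HE₁⟩ := exists_exp_le_rpow (c := κ * ((1 - u / v) / 2)) (by positivity)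
  obtain ⟨E₂, hE₂, HE₂⟩ := exists_exp_le_rpow (c := μ * ((1 - u / v) / 4)) (by positivity)
  refine ⟨D + D * (|C₁| * E₁ + C * P * E₂), 4, by norm_num, fun x t I hI hI' r hr hcross => ?_⟩
  have hrest : 0 ≤ D * (|C₁| * E₁ + C * P * E₂) := by positivity
  rcases hr.eq_or_lt with rfl | hr
  · have := hbd (fun i => S.put (x i) (t i) (a i)) fun i => by
      refine (M.N_centre_le _).trans ?_
      rw [put, M.N_ι, M.N_τ]
      gcongr
      exact (hQi i).trans (by linarith)
    refine this.trans ?_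
    simpa using hrest
  obtain ⟨L, hL, hL', hord⟩ := exists_ordered_split hv0.le hr.le x t hI hI' hcross
  obtain ⟨t₀, ht₀⟩ := exists_separating_time hu0 huv x t hL hL' hord
  set δ := (1 - u / v) * r with hδ
  have hδ0 : 0 < δ := by positivity
  choose b₀ hb₀ hN₀ using fun i => H₀ i (t i - t₀) (δ / 4) (by positivity)
  set w : Fin n → ℝ := fun i => vLR * |t i - t₀| + δ / 4 with hw
  set η := C * Real.exp (-(μ * (δ / 4))) with hη
  have hη0 : 0 ≤ η := by positivity
  have hηC : η ≤ C := mul_le_of_le_one_right hC0 (Real.exp_le_one_iff.2 (by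
    have : 0 ≤ μ * (δ / 4) := by positivity
    linarith))
  have hNb : ∀ i, M.N (S.τ (t i - t₀) (a i) - b₀ i) ≤ η := fun i => by
    refine (hN₀ i).trans ?_
    have h1 : Real.exp (-(μ₀ i * (δ / 4))) ≤ Real.exp (-(μ * (δ / 4))) := by
      gcongr
      exact hμ i
    calc C₀ i * Real.exp (-(μ₀ i * (δ / 4))) ≤ C * Real.exp (-(μ₀ i * (δ / 4))) := by
          gcongr
          exact hCi i
      _ ≤ η := by
          rw [hη]
          gcongr
  set a' : Fin n → A := fun i => S.ι (x i) (S.τ (t i - t₀) (a i)) with ha'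
  set b : Fin n → A := fun i => S.ι (x i) (b₀ i) with hb
  have hab : ∀ i, M.N (a' i - b i) ≤ η := fun i => by
    simp only [ha', hb]
    rw [← map_sub, M.N_ι]
    exact hNb i
  have hNa' : ∀ i, M.N (a' i) ≤ Q := fun i => by
    simp only [ha', M.N_ι, M.N_τ]
    exact hQi i
  have hNb' : ∀ i, M.N (b i) ≤ Q + C := fun i => by
    have h1 := map_sub_le_add M.N (a' i) (a' i - b i)
    rw [sub_sub_cancel] at h1
    linarith [hab i, hNa' i]
  have hmem : ∀ i, b i ∈ M.loc (x i - w i) (x i + w i) := fun i => by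
    have := M.covariant (x i) _ _ _ (hb₀ i)
    rwa [neg_add_eq_sub, add_comm _ (x i)] at this
  obtain ⟨i₁, hi₁, e₁⟩ := Finset.exists_mem_eq_sup' hL fun i => x i + w i
  obtain ⟨j₁, hj₁, e₂⟩ := Finset.exists_mem_eq_inf' hL' fun j => x j - w j
  set rL := L.sup' hL fun i => x i + w i
  set lR := Lᶜ.inf' hL' fun j => x j - w j
  have hgap : δ / 2 ≤ lR - rL := by
    have h1 := ht₀ i₁ hi₁ j₁ hj₁
    have h2 : vLR * |t i₁ - t₀| ≤ u * |t i₁ - t₀| := by gcongr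
    have h3 : vLR * |t j₁ - t₀| ≤ u * |t j₁ - t₀| := by gcongr
    rw [e₁, e₂]
    simp only [hw]
    linarith
  set B := M.loc (L.inf' hL fun i => x i - w i) rL
  set B' := M.loc lR (Lᶜ.sup' hL' fun j => x j + w j)
  have hind : M.Indep B B' (|C₁| * Real.exp (-(κ * (δ / 2)))) := by
    refine ⟨by positivity, M.commute _ _ _ _ (by linarith), fun p hp q hq => ?_⟩
    refine (H₁ _ _ _ _ (by linarith) p hp q hq).trans ?_
    have hpq : 0 ≤ M.N p * M.N q := mul_nonneg (apply_nonneg _ _) (apply_nonneg _ _)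
    have h1 : Real.exp (-(κ * (lR - rL))) ≤ Real.exp (-(κ * (δ / 2))) := by gcongr
    calc C₁ * M.N p * M.N q * Real.exp (-(κ * (lR - rL)))
        = C₁ * (Real.exp (-(κ * (lR - rL))) * (M.N p * M.N q)) := by ring
      _ ≤ |C₁| * (Real.exp (-(κ * (lR - rL))) * (M.N p * M.N q)) := by
          gcongr
          exact le_abs_self _
      _ ≤ |C₁| * (Real.exp (-(κ * (δ / 2))) * (M.N p * M.N q)) := by gcongr
      _ = _ := by ring
  have hfin := hfac _ (η * P) B B' (by positivity) hind a' b L hL hL'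
    (fun i => (M.N_centre_le _).trans (by gcongr; linarith [hNa' i]))
    (fun i => (M.N_centre_le _).trans (by gcongr; exact hNb' i))
    (fun i => by
      have e : S.centre (a' i) - S.centre (b i) = S.centre (a' i - b i) := by
        simp only [centre, map_sub]
        abel
      rw [e]
      refine (M.N_centre_le _).trans ?_
      gcongr
      exact hab i)
    (fun i hi => M.mono (Finset.inf'_le (fun i => x i - w i) hi)
      (Finset.le_sup' (fun i => x i + w i) hi) (hmem i))
    (fun i hi => M.mono (Finset.inf'_le (fun i => x i - w i) hi)
      (Finset.le_sup' (fun i => x i + w i) hi) (hmem i))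
  have htr : F (fun i => S.ι (x i) (S.τ (t i) (a i))) = F a' := by
    rw [← hτ (-t₀)]
    congr 1
    ext i
    rw [← S.ι_τ_comm, ← S.τ_add, neg_add_eq_sub]
  rw [htr]
  refine hfin.trans ?_
  have k1 := HE₁ r hr.le
  have k2 := HE₂ r hr.le
  have r1 : κ * (δ / 2) = κ * ((1 - u / v) / 2) * r := by rw [hδ]; ring
  have r2 : μ * (δ / 4) = μ * ((1 - u / v) / 4) * r := by rw [hδ]; ring
  rw [hη, r1, r2]
  have hρ : 0 ≤ (1 + r) ^ (-4 : ℝ) := by positivity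
  calc D * (|C₁| * Real.exp (-(κ * ((1 - u / v) / 2) * r))
        + C * Real.exp (-(μ * ((1 - u / v) / 4) * r)) * P)
      ≤ D * (|C₁| * (E₁ * (1 + r) ^ (-4 : ℝ)) + C * (E₂ * (1 + r) ^ (-4 : ℝ)) * P) := by gcongr
    _ = D * (|C₁| * E₁ + C * P * E₂) * (1 + r) ^ (-4 : ℝ) := by ring
    _ ≤ (D + D * (|C₁| * E₁ + C * P * E₂)) * (1 + r) ^ (-4 : ℝ) := by
        gcongr
        linarith

end LocalNet

theorem clustering_of_liebRobinson {M : S.LocalNet} {vLR v : ℝ} (h0 : 0 ≤ vLR) (hv : vLR < v)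
    (hLR : M.LiebRobinson vLR) (hexp : M.ExpClustering) : S.Clustering v := by
  refine ⟨LocalNet.factorizing_conn₂.clusteringOf (fun s a => ?_) h0 hv hLR hexp,
    LocalNet.factorizing_conn₃.clusteringOf (fun s a => ?_) h0 hv hLR hexp,
    LocalNet.factorizing_conn₄.clusteringOf (fun s a => ?_) h0 hv hLR hexp⟩
  · simp only [conn₂, centre_evolve, ← map_mul (S.τ s), S.ω_τ]
  · simp only [conn₃, centre_evolve, ← map_mul (S.τ s), S.ω_τ]
  · simp only [conn₄, centre_evolve, ← map_mul (S.τ s), S.ω_τ]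

end System
end HydroProj
end

theorem mainTheorem1 {A : Type*} [Ring A] [StarRing A] [Algebra ℂ A] [StarModule ℂ A]
    (S : HydroProj.System A) (q₁ j₁ q₂ j₂ : S.V)
    (h₁ : S.IsConserved q₁ j₁) (h₂ : S.IsConserved q₂ j₂) :
    (∀ v : ℝ, 0 < v → S.Clustering v →
      S.DiffusionBound q₁ q₂ v ∧
      (∀ a p : S.V, S.ballistic.starProjection (S.cls a) = S.cls p →
        MeasureTheory.Integrable (fun y : ℝ × ℝ =>
          S.conn₃ ![S.ι y.1 (q₁ : A), S.ι y.2 (q₂ : A), ((a - p : S.V) : A)]) ∧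
        S.BilinearValue q₁ q₂ (S.coProj (S.cls a)) (S.bilinear q₁ q₂ (a - p))) ∧
      (∀ q₃ j₃ : S.V, S.IsConserved q₃ j₃ → ∀ z : ℂ, z ≠ 0 →
        S.BilinearValue q₁ q₂ (S.coProj (S.cls j₃)) z → 0 < S.lowerOnsager (S.cls j₃))) ∧
    (∀ v₀ : ℝ, 0 ≤ v₀ → (∀ v : ℝ, v₀ < v → S.Clustering v) → S.DiffusionBound q₁ q₂ v₀) ∧
    (∀ (M : S.LocalNet) (vLR : ℝ), 0 ≤ vLR → M.LiebRobinson vLR → M.ExpClustering →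
      (∀ v : ℝ, vLR < v → S.Clustering v) ∧ S.DiffusionBound q₁ q₂ vLR) := by
  have bound : ∀ v₀ : ℝ, 0 ≤ v₀ → (∀ v : ℝ, v₀ < v → S.Clustering v) →
      S.DiffusionBound q₁ q₂ v₀ := fun v₀ h0 hc =>
    HydroProj.System.diffusionBound_of_forall_gt fun v hv =>
      HydroProj.System.diffusionBound_of_clustering (h0.trans_lt hv) (hc v hv) h₁ h₂
  refine ⟨fun v hv hc => ?_, bound, fun M vLR h0 hLR hexp => ?_⟩
  · have hD := HydroProj.System.diffusionBound_of_clustering hv hc h₁ h₂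
    refine ⟨hD, fun a p hp => ⟨HydroProj.System.integrable_conn₃ hc.2.1 h₁.average_eq_zero
      h₂.average_eq_zero _, ?_⟩, fun q₃ j₃ _ z hz hB => ?_⟩
    · rw [HydroProj.System.coProj_apply, hp, ← S.cls_sub]
      exact HydroProj.System.bilinearValue_cls hc.2.1 h₁.average_eq_zero h₂.average_eq_zero _
    · refine lt_of_lt_of_le (ENNReal.div_pos ?_ ENNReal.ofReal_ne_top) (hD j₃ z hB)
      rw [ne_eq, ENNReal.ofReal_eq_zero, not_le]
      positivity
  · have hc := fun v hv => HydroProj.System.clustering_of_liebRobinson (v := v) h0 hv hLR hexp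
    exact ⟨hc, bound vLR h0 hc⟩
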